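/- For $x\in\mathbb R$ let $\|x\|$ denote the distance from $x$ to the nearest integer. An approximation sequence is a positive, non-increasing sequence $\psi=(\psi(n))_{n\ge 1}$ of real numbers. For real $\tau\ge 1$ put \[ \Omega^{(\tau)}=\{\theta\in\mathbb R:\ \text{there is } c>0 \text{ with } \|n\theta\|\ge c/n^{\tau}\text{ for all } n\ge 1\}, \] and let $\Theta^{(\tau)}$ be the set of all $\theta\in\mathbb R$ such that, for every approximation sequence $\psi$ with $\sum_{n\ge1}\psi(n)^{\tau}=\infty$, for almost all $s\in\mathbb R$ (Lebesgue measure) the inequality $\|n\theta-s\|<\psi(n)$ has infinitely many solutions $n\in\mathbb N$. (1) (Tseng) For every real $\tau\ge1$, $\Omega^{(\tau)}=\Theta^{(\tau)}$. (2) (Kurzweil; the case $\tau=1$) A real number $\theta$ is badly approximable, i.e. there is $c>0$ with $\|n\theta\|\ge c/n$ for all $n\ge1$, if and only if for every approximation sequence $\psi$ with $\sum_{n\ge1}\psi(n)=\infty$ and for almost all $s\in\mathbb R$ the inequality $\|n\theta-s\|<\psi(n)$ has infinitely many solutions $n\in\mathbb N$. (3) (Tseng's sequences) Let $\tau\ge1$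 be real and $\theta\in\mathbb R\setminus\Omega^{(\tau)}$. There are positive integers $v_1,v_2,\dots$ with \[ v_{\ell+1}\ge 2v_\ell\quad\text{and}\quad \|v_\ell\theta\|\le\frac{1}{2\,\ell^{2\tau+2}v_\ell^{\tau}}\qquad(\ell\ge1). \] For each such $(v_\ell)_{\ell\ge1}$, with $u_\ell=\lfloor \ell^{2\tau}v_\ell^{\tau}\rfloor$, there is an approximation sequence $\psi$ such that \[ \psi(n)=\frac{1}{2(\ell+1)^2v_{\ell+1}}\qquad\text{for } u_\ell\le n<u_{\ell+1},\ \ell\ge1, \] and every approximation sequence $\psi$ with this property satisfies $\sum_{n\ge1}\psi(n)^{\tau}=\infty$; moreover, if $\theta$ is irrational with principal convergents $p_k/q_k$, then \[ \sum_{k=0}^{\infty}\ \sum_{n=q_k}^{q_{k+1}-1}\min\bigl(\psi(n),\|q_k\theta\|\bigr)<\infty ; \] and for almost all $s\in\mathbb R$ the inequality $\|n\theta-s\|<\psi(n)$ has only finitely many solutions $n\in\mathbb N$. -/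

import Mathlib

open MeasureTheory

/-- The distance `‖x‖` from `x` to the nearest integer. -/
noncomputable def distInt (x : ℝ) : ℝ := |x - round x|

/-- A positive, non-increasing sequence `ψ(1), ψ(2), …`; the value `ψ 0` is irrelevant. -/
structure IsApproxSeq (ψ : ℕ → ℝ) : Prop where
  pos : ∀ n, 1 ≤ n → 0 < ψ n
  anti : ∀ m n, 1 ≤ m → m ≤ n → ψ n ≤ ψ m

/-- The positive integers `n` with `‖nθ - s‖ < ψ(n)`. -/
def solutions (θ : ℝ) (ψ : ℕ → ℝ) (s : ℝ) : Set ℕ :=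
  {n | 1 ≤ n ∧ distInt (n * θ - s) < ψ n}

/-- `∑_{n ≥ 1} ψ(n)^τ = ∞` (the terms are positive for an approximation sequence). -/
def PowDiverges (τ : ℝ) (ψ : ℕ → ℝ) : Prop :=
  ¬ Summable (fun n : ℕ => ψ (n + 1) ^ τ)

/-- `Ω^{(τ)}`. -/
def omegaSet (τ : ℝ) : Set ℝ :=
  {θ | ∃ c : ℝ, 0 < c ∧ ∀ n : ℕ, 1 ≤ n → c / (n : ℝ) ^ τ ≤ distInt (n * θ)}

/-- `Θ^{(τ)}`. -/
def thetaSet (τ : ℝ) : Set ℝ :=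
  {θ | ∀ ψ : ℕ → ℝ, IsApproxSeq ψ → PowDiverges τ ψ →
    ∀ᵐ s : ℝ, (solutions θ ψ s).Infinite}

/-- The badly approximable numbers. -/
def badlyApproximable : Set ℝ :=
  {θ | ∃ c : ℝ, 0 < c ∧ ∀ n : ℕ, 1 ≤ n → c / n ≤ distInt (n * θ)}

/-- The denominator `q_k` of the `k`-th principal convergent of `θ`, as a natural number. -/
noncomputable def convDenom (θ : ℝ) (k : ℕ) : ℕ := ⌊(GenContFract.of θ).dens k⌋₊

/-- The floor in `convDenom` only changes the type: the denominators are natural numbers. -/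
theorem convDenom_cast (θ : ℝ) (k : ℕ) : (convDenom θ k : ℝ) = (GenContFract.of θ).dens k := by
  have key : ∀ k, (∃ a : ℤ, (GenContFract.of θ).dens k = a) ∧
      (∃ a : ℤ, (GenContFract.of θ).dens (k + 1) = a) := by
    intro k
    induction k with
    | zero =>
      refine ⟨⟨1, by simp⟩, ?_⟩
      rcases h : (GenContFract.of θ).s.get? 0 with _ | gp
      · refine ⟨1, ?_⟩
        rw [GenContFract.dens_stable_of_terminated (Nat.zero_le 1)
          (show (GenContFract.of θ).TerminatedAt 0 from h)]
        simp
      · obtain ⟨-, z, hz⟩ := GenContFract.of_partNum_eq_one_and_exists_int_partDen_eq h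
        exact ⟨z, by rw [GenContFract.first_den_eq h, hz]⟩
    | succ k ih =>
      obtain ⟨⟨a, ha⟩, ⟨b, hb⟩⟩ := ih
      refine ⟨⟨b, hb⟩, ?_⟩
      rcases h : (GenContFract.of θ).s.get? (k + 1) with _ | gp
      · exact ⟨b, by rw [GenContFract.dens_stable_of_terminated (Nat.le_succ (k + 1))
          (show (GenContFract.of θ).TerminatedAt (k + 1) from h), hb]⟩
      · obtain ⟨h1, z, hz⟩ := GenContFract.of_partNum_eq_one_and_exists_int_partDen_eq h
        refine ⟨z * b + a, ?_⟩
        rw [GenContFract.dens_recurrence h ha hb, h1, hz]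
        push_cast
        ring
  obtain ⟨⟨a, ha⟩, -⟩ := key k
  have h0 : (0 : ℝ) ≤ (GenContFract.of θ).dens k := GenContFract.zero_le_of_den
  rw [ha] at h0
  have h0' : 0 ≤ a := by exact_mod_cast h0
  lift a to ℕ using h0'
  rw [convDenom, ha]
  simp

/-- The `k`-th term `∑_{n = q_k}^{q_{k+1} - 1} min(ψ(n), ‖q_k θ‖)` of the criterion series. -/
noncomputable def blockSum (θ : ℝ) (ψ : ℕ → ℝ) (k : ℕ) : ℝ :=
  ∑ n ∈ Finset.Ico (convDenom θ k) (convDenom θ (k + 1)),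
    min (ψ n) (distInt (convDenom θ k * θ))

/-- Positive integers `v_1, v_2, …` with `v_{ℓ+1} ≥ 2 v_ℓ` and
`‖v_ℓ θ‖ ≤ 1 / (2 ℓ^{2τ+2} v_ℓ^τ)`. -/
structure IsTsengBase (τ θ : ℝ) (v : ℕ → ℕ) : Prop where
  pos : ∀ l, 1 ≤ l → 1 ≤ v l
  double : ∀ l, 1 ≤ l → 2 * v l ≤ v (l + 1)
  approx : ∀ l, 1 ≤ l →
    distInt (v l * θ) ≤ 1 / (2 * (l : ℝ) ^ (2 * τ + 2) * (v l : ℝ) ^ τ)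

/-- `u_ℓ = ⌊ℓ^{2τ} v_ℓ^τ⌋`. -/
noncomputable def tsengIndex (τ : ℝ) (v : ℕ → ℕ) (l : ℕ) : ℕ :=
  ⌊(l : ℝ) ^ (2 * τ) * (v l : ℝ) ^ τ⌋₊

/-- `ψ` is an approximation sequence with `ψ(n) = 1 / (2 (ℓ+1)^2 v_{ℓ+1})` for
`u_ℓ ≤ n < u_{ℓ+1}`, `ℓ ≥ 1`. The finitely many values `ψ(n)` with `n < u_1`
are not prescribed. -/
structure IsTsengSeq (τ : ℝ) (v : ℕ → ℕ) (ψ : ℕ → ℝ) : Prop where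
  approxSeq : IsApproxSeq ψ
  eq : ∀ l, 1 ≤ l → ∀ n, tsengIndex τ v l ≤ n → n < tsengIndex τ v (l + 1) →
    ψ n = 1 / (2 * ((l : ℝ) + 1) ^ 2 * (v (l + 1) : ℝ))

/-! ### Distance to the nearest integer -/

/-! Write `q_l` for the convergent denominators; `‖x‖` is the norm on the circle.

For `Ω ⊆ Θ`, `θ` is irrational. If `ψ(q_l) ≥ 2 / q_l` for infinitely many `l`, density of the first
`q_l` multiples approximates every point off the orbit. Otherwise cut the multiples up to index
`q_{l+1}` into runs of length `q_l`, discarding an incomplete last run, and surround those of run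
`j` by balls of radius `min(ψ((j+1)q_l), 1/(4q_{l+1}))`. The cap makes the balls of one block
disjoint. Membership in `Ω` gives `c q_l^{-τ} ≤ ‖q_l θ‖ ≤ 1/q_{l+1}`, so even the capped radii
dominate a multiple of `ψ^τ`, and the block measures have divergent sum (`rpow_le_mul_runRadius`,
`sum_Ico_le_mul_sum`). Equidistribution of a run of `q_l` multiples makes the blocks
quasi-independent (`measureReal_blockSet_inter_le`). A second moment argument then yields a limsup
of positive measure, and ergodicity of the rotation makes it full.

Conversely, for `θ` outside `Ω`, choose `v_ℓ` with `‖v_ℓ θ‖` tiny. Up to index `u_ℓ` the multiples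
of `θ` stay close to the first `v_ℓ` of them, so few balls cover a whole block of solutions and
Borel–Cantelli applies, although `u_ℓ` is large enough for `∑ ψ^τ` to diverge. -/

theorem distInt_eq_norm (x : ℝ) : distInt x = ‖(x : UnitAddCircle)‖ :=
  (UnitAddCircle.norm_eq (x := x)).symm

theorem distInt_nonneg (x : ℝ) : 0 ≤ distInt x := abs_nonneg _

theorem distInt_le (x : ℝ) (m : ℤ) : distInt x ≤ |x - m| := round_le x m

theorem distInt_pos {x : ℝ} (hx : Irrational x) : 0 < distInt x := by
  refine abs_pos.2 fun h => ?_
  exact hx.ne_int (round x) (by linarith)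

/-! ### Convergents of an irrational number -/

theorem GenContFract.of_not_terminatedAt {θ : ℝ} (hθ : Irrational θ) (k : ℕ) :
    ¬ (GenContFract.of θ).TerminatedAt k := by
  intro h
  obtain ⟨q, hq⟩ := (GenContFract.terminates_iff_rat θ).1 ⟨k, h⟩
  exact hθ ⟨q, hq.symm⟩

theorem GenContFract.exists_int_nums_eq (θ : ℝ) (k : ℕ) :
    ∃ a : ℤ, (GenContFract.of θ).nums k = a := by
  have key : ∀ k, (∃ a : ℤ, (GenContFract.of θ).nums k = a) ∧
      (∃ a : ℤ, (GenContFract.of θ).nums (k + 1) = a) := by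
    intro k
    induction k with
    | zero =>
      refine ⟨⟨⌊θ⌋, by simp⟩, ?_⟩
      rcases h : (GenContFract.of θ).s.get? 0 with _ | gp
      · refine ⟨⌊θ⌋, ?_⟩
        rw [GenContFract.nums_stable_of_terminated (Nat.zero_le 1)
          (show (GenContFract.of θ).TerminatedAt 0 from h)]
        simp
      · obtain ⟨h1, z, hz⟩ := GenContFract.of_partNum_eq_one_and_exists_int_partDen_eq h
        refine ⟨z * ⌊θ⌋ + 1, ?_⟩
        rw [GenContFract.first_num_eq h, hz, h1]
        simp
    | succ k ih =>
      obtain ⟨⟨a, ha⟩, ⟨b, hb⟩⟩ := ih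
      refine ⟨⟨b, hb⟩, ?_⟩
      rcases h : (GenContFract.of θ).s.get? (k + 1) with _ | gp
      · exact ⟨b, by rw [GenContFract.nums_stable_of_terminated (Nat.le_succ (k + 1))
          (show (GenContFract.of θ).TerminatedAt (k + 1) from h), hb]⟩
      · obtain ⟨h1, z, hz⟩ := GenContFract.of_partNum_eq_one_and_exists_int_partDen_eq h
        refine ⟨z * b + a, ?_⟩
        rw [GenContFract.nums_recurrence h ha hb, h1, hz]
        push_cast
        ring
  exact (key k).1

/-- The numerator `p_k` of the `k`-th principal convergent, as an integer. -/
noncomputable def convNum (θ : ℝ) (k : ℕ) : ℤ := ⌊(GenContFract.of θ).nums k⌋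

theorem convNum_cast (θ : ℝ) (k : ℕ) : (convNum θ k : ℝ) = (GenContFract.of θ).nums k := by
  obtain ⟨a, ha⟩ := GenContFract.exists_int_nums_eq θ k
  simp [convNum, ha]

theorem convDenom_zero (θ : ℝ) : convDenom θ 0 = 1 := by simp [convDenom]

theorem convDenom_mono (θ : ℝ) : Monotone (convDenom θ) := by
  refine monotone_nat_of_le_succ fun k => ?_
  have : (convDenom θ k : ℝ) ≤ convDenom θ (k + 1) := by
    simpa only [convDenom_cast] using GenContFract.of_den_mono
  exact_mod_cast this

theorem convDenom_pos (θ : ℝ) (k : ℕ) : 1 ≤ convDenom θ k :=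
  (convDenom_zero θ) ▸ convDenom_mono θ (Nat.zero_le k)

theorem convDenom_add_le {θ : ℝ} (hθ : Irrational θ) (k : ℕ) :
    convDenom θ (k + 1) + convDenom θ k ≤ convDenom θ (k + 2) := by
  obtain ⟨gp, h⟩ := Option.ne_none_iff_exists'.1 (GenContFract.of_not_terminatedAt hθ (k + 1))
  have h1 := (GenContFract.of_partNum_eq_one_and_exists_int_partDen_eq h).1
  have hb : (1 : ℝ) ≤ gp.b :=
    GenContFract.of_one_le_get?_partDen (GenContFract.partDen_eq_s_b h)
  have hr := GenContFract.dens_recurrence h (convDenom_cast θ k).symm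
    (convDenom_cast θ (k + 1)).symm
  rw [← convDenom_cast, h1] at hr
  have : (convDenom θ (k + 1) : ℝ) + convDenom θ k ≤ convDenom θ (k + 2) := by
    rw [hr]
    nlinarith [Nat.cast_nonneg (α := ℝ) (convDenom θ (k + 1))]
  exact_mod_cast this

theorem two_mul_convDenom_le {θ : ℝ} (hθ : Irrational θ) (k : ℕ) :
    2 * convDenom θ k ≤ convDenom θ (k + 2) := by
  have := convDenom_add_le hθ k
  have : convDenom θ k ≤ convDenom θ (k + 1) := convDenom_mono θ (Nat.le_succ k)
  omega

theorem convDenom_tendsto {θ : ℝ} (hθ : Irrational θ) :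
    Filter.Tendsto (convDenom θ) Filter.atTop Filter.atTop := by
  have hk : ∀ k, k ≤ convDenom θ (k + 1) := by
    intro k
    induction k with
    | zero => exact Nat.zero_le _
    | succ k ih =>
      have := convDenom_add_le hθ k
      have := convDenom_pos θ k
      change k + 1 ≤ convDenom θ (k + 2)
      omega
  refine Filter.tendsto_atTop_mono' _ ?_ (Filter.tendsto_sub_atTop_nat 1)
  filter_upwards [Filter.eventually_ge_atTop 1] with k h
  have := hk (k - 1)
  rwa [Nat.sub_add_cancel h] at this

theorem abs_convDenom_mul_sub_le {θ : ℝ} (hθ : Irrational θ) (k : ℕ) :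
    |convDenom θ k * θ - convNum θ k| ≤ 1 / convDenom θ (k + 1) := by
  have h := GenContFract.abs_sub_convs_le (GenContFract.of_not_terminatedAt hθ k)
  rw [GenContFract.conv_eq_num_div_den, ← convDenom_cast, ← convDenom_cast, ← convNum_cast] at h
  have h0 : (0 : ℝ) < convDenom θ k := by exact_mod_cast convDenom_pos θ k
  have h1 : (0 : ℝ) < convDenom θ (k + 1) := by exact_mod_cast convDenom_pos θ (k + 1)
  have e : (convDenom θ k * θ - convNum θ k : ℝ)
      = convDenom θ k * (θ - convNum θ k / convDenom θ k) := by field_simp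
  rw [e, abs_mul, abs_of_pos h0]
  calc _ ≤ (convDenom θ k : ℝ) * (1 / (convDenom θ k * convDenom θ (k + 1))) := by gcongr
    _ = _ := by field_simp

theorem conv_determinant {θ : ℝ} (hθ : Irrational θ) (k : ℕ) :
    convNum θ k * convDenom θ (k + 1) - convDenom θ k * convNum θ (k + 1) = (-1 : ℤ) ^ (k + 1) := by
  have h := SimpContFract.determinant (s := SimpContFract.of θ)
    (GenContFract.of_not_terminatedAt hθ k)
  change (GenContFract.of θ).nums k * (GenContFract.of θ).dens (k + 1) -
    (GenContFract.of θ).dens k * (GenContFract.of θ).nums (k + 1) = _ at h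
  simp only [← convDenom_cast, ← convNum_cast] at h
  exact_mod_cast h

theorem convDenom_mul_sub_ne_zero {θ : ℝ} (hθ : Irrational θ) (k : ℕ) :
    (convDenom θ k * θ - convNum θ k : ℝ) ≠ 0 := by
  have := convDenom_pos θ k
  have h := (hθ.natCast_mul (m := convDenom θ k) (by omega)).ne_int (convNum θ k)
  exact sub_ne_zero.2 h

/-- Consecutive convergents lie on opposite sides of the number. -/
theorem convDenom_mul_sub_mul_neg {θ : ℝ} (hθ : Irrational θ) (k : ℕ) :
    (convDenom θ k * θ - convNum θ k) *
      (convDenom θ (k + 1) * θ - convNum θ (k + 1)) < 0 := by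
  have hd := conv_determinant hθ k
  have hd' : ((convNum θ k * convDenom θ (k + 1) - convDenom θ k * convNum θ (k + 1) : ℤ) : ℝ) ^ 2
      = 1 := by rw [hd]; push_cast; rw [← pow_mul, mul_comm, pow_mul]; simp
  push_cast at hd'
  have a0 := abs_convDenom_mul_sub_le hθ k
  have a1 := abs_convDenom_mul_sub_le hθ (k + 1)
  have n0 := convDenom_mul_sub_ne_zero hθ k
  have n1 := convDenom_mul_sub_ne_zero hθ (k + 1)
  have h0 : (0 : ℝ) < convDenom θ k := by exact_mod_cast convDenom_pos θ k
  have h1 : (0 : ℝ) < convDenom θ (k + 1) := by exact_mod_cast convDenom_pos θ (k + 1)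
  have h2 : (convDenom θ k : ℝ) ≤ convDenom θ (k + 2) := by
    exact_mod_cast convDenom_mono θ (by omega : k ≤ k + 2)
  rw [le_div_iff₀ h1] at a0
  rw [le_div_iff₀ (by linarith)] at a1
  set x := (convDenom θ k * θ - convNum θ k : ℝ) with hx
  set y := (convDenom θ (k + 1) * θ - convNum θ (k + 1) : ℝ) with hy
  set a := (convDenom θ k : ℝ)
  set b := (convDenom θ (k + 1) : ℝ)
  have e : (convNum θ k * b - a * convNum θ (k + 1) : ℝ) = a * y - b * x := by rw [hx, hy]; ring
  rw [e] at hd'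
  -- The determinant `a y - b x` is `±1`, while `a y` and `b x` have modulus at most 1. Nonzero
  -- numbers of the same sign with this bound cannot differ by `±1`.
  by_contra hneg
  have hxy : 0 < x * y := lt_of_le_of_ne (not_lt.1 hneg) (mul_ne_zero n0 n1).symm
  have b0 : (b * x) ^ 2 ≤ 1 := by
    rw [sq_le_one_iff_abs_le_one, abs_mul, abs_of_pos h1]; linarith
  have b1 : (a * y) ^ 2 ≤ 1 := by
    rw [sq_le_one_iff_abs_le_one, abs_mul, abs_of_pos h0]
    nlinarith [abs_nonneg y]
  have hp : 0 < (a * y) * (b * x) := by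
    have : (a * y) * (b * x) = a * b * (x * y) := by ring
    rw [this]; positivity
  rcases le_total ((a * y) ^ 2) ((b * x) ^ 2) with h | h
  · have : |a * y| ≤ |b * x| := sq_le_sq.1 h
    have h3 : (a * y) ^ 2 ≤ (a * y) * (b * x) := by
      rw [← abs_of_pos hp, abs_mul, ← sq_abs]
      nlinarith [abs_nonneg (a * y)]
    nlinarith
  · have : |b * x| ≤ |a * y| := sq_le_sq.1 h
    have h3 : (b * x) ^ 2 ≤ (a * y) * (b * x) := by
      rw [← abs_of_pos hp, abs_mul, ← sq_abs]
      nlinarith [abs_nonneg (b * x)]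
    nlinarith

/-- The law of best approximation. -/
theorem abs_convDenom_mul_sub_le_abs {θ : ℝ} (hθ : Irrational θ) (k : ℕ) {n : ℕ} (hn : 1 ≤ n)
    (hnk : n < convDenom θ (k + 1)) (m : ℤ) :
    |convDenom θ k * θ - convNum θ k| ≤ |n * θ - m| := by
  have hd := conv_determinant hθ k
  have hsign := convDenom_mul_sub_mul_neg hθ k
  set x := (convDenom θ k * θ - convNum θ k : ℝ) with hx
  set y := (convDenom θ (k + 1) * θ - convNum θ (k + 1) : ℝ) with hy
  obtain ⟨ε, hε, hεd⟩ : ∃ ε : ℤ, ε * ε = 1 ∧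
      convNum θ k * convDenom θ (k + 1) - convDenom θ k * convNum θ (k + 1) = ε :=
    ⟨_, by rw [← pow_add, ← two_mul, pow_mul]; simp, hd⟩
  have hq0 : (1 : ℤ) ≤ convDenom θ k := by exact_mod_cast convDenom_pos θ k
  have hq1 : (n : ℤ) < convDenom θ (k + 1) := by exact_mod_cast hnk
  have hn' : (1 : ℤ) ≤ n := by exact_mod_cast hn
  -- Two consecutive convergents form a basis of `ℤ²`; `a` and `b` are the coordinates of `(n, m)`
  -- by Cramer's rule. Since `1 ≤ n < q_{k+1}`, `a` is nonzero and `a b ≤ 0`. As `x y < 0`, the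
  -- terms `a x` and `b y` do not cancel.
  obtain ⟨a, ha⟩ : ∃ a : ℤ, a = ε * (m * convDenom θ (k + 1) - n * convNum θ (k + 1)) := ⟨_, rfl⟩
  obtain ⟨b, hb⟩ : ∃ b : ℤ, b = ε * (n * convNum θ k - m * convDenom θ k) := ⟨_, rfl⟩
  have e1 : (n : ℤ) = a * convDenom θ k + b * convDenom θ (k + 1) := by
    rw [ha, hb]; linear_combination (-(n : ℤ)) * hε - n * ε * hεd
  have e2 : m = a * convNum θ k + b * convNum θ (k + 1) := by
    rw [ha, hb]; linear_combination (-m) * hε - m * ε * hεd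
  have e3 : (n * θ - m : ℝ) = a * x + b * y := by
    have e1' : (n : ℝ) = a * convDenom θ k + b * convDenom θ (k + 1) := by exact_mod_cast e1
    have e2' : (m : ℝ) = a * convNum θ k + b * convNum θ (k + 1) := by exact_mod_cast e2
    rw [e1', e2', hx, hy]; ring
  have ha0 : a ≠ 0 := by
    rintro rfl
    have : 0 < b := by
      by_contra hb0
      nlinarith
    nlinarith
  have hab : a * b ≤ 0 := by
    by_contra hab
    rcases pos_and_pos_or_neg_and_neg_of_mul_pos (not_le.1 hab) with ⟨h1, h2⟩ | ⟨h1, h2⟩ <;> nlinarith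
  have hab' : (a * b : ℝ) ≤ 0 := by exact_mod_cast hab
  have ha1 : (1 : ℝ) ≤ (a : ℝ) ^ 2 := by
    have : 1 ≤ a ^ 2 := Int.add_one_le_iff.2 (sq_pos_of_ne_zero ha0)
    exact_mod_cast this
  rw [e3]
  apply sq_le_sq.1
  nlinarith [mul_nonneg_of_nonpos_of_nonpos hab' hsign.le, sq_nonneg (b * y), sq_nonneg x]

theorem distInt_convDenom_mul_le {θ : ℝ} (hθ : Irrational θ) (k : ℕ) :
    distInt (convDenom θ k * θ) ≤ 1 / convDenom θ (k + 1) :=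
  (distInt_le _ (convNum θ k)).trans (abs_convDenom_mul_sub_le hθ k)

theorem distInt_convDenom_mul_le_distInt {θ : ℝ} (hθ : Irrational θ) (k : ℕ) {n : ℕ} (hn : 1 ≤ n)
    (hnk : n < convDenom θ (k + 1)) : distInt (convDenom θ k * θ) ≤ distInt (n * θ) :=
  (distInt_le _ (convNum θ k)).trans (abs_convDenom_mul_sub_le_abs hθ k hn hnk _)

/-- With `x_k = q_k θ - p_k`, the determinant gives `1 ≤ q_k |x_{k+1}| + q_{k+1} |x_k|`. The first
term is at most `q_k / q_{k+2} ≤ 1/2`, so `|x_k| ≥ 1/(2 q_{k+1})`, and best approximation carries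
this to `n`. -/
theorem one_div_le_distInt {θ : ℝ} (hθ : Irrational θ) (k : ℕ) {n : ℕ} (hn : 1 ≤ n)
    (hnk : n < convDenom θ (k + 1)) : 1 / (2 * convDenom θ (k + 1)) ≤ distInt (n * θ) := by
  refine le_trans ?_ (abs_convDenom_mul_sub_le_abs hθ k hn hnk (round (n * θ)))
  have hd := conv_determinant hθ k
  have hd' : |((convNum θ k * convDenom θ (k + 1) - convDenom θ k * convNum θ (k + 1) : ℤ) : ℝ)|
      = 1 := by rw [hd]; simp
  push_cast at hd'
  have a1 := abs_convDenom_mul_sub_le hθ (k + 1)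
  have h0 : (0 : ℝ) < convDenom θ k := by exact_mod_cast convDenom_pos θ k
  have h1 : (0 : ℝ) < convDenom θ (k + 1) := by exact_mod_cast convDenom_pos θ (k + 1)
  have h2 : (2 * convDenom θ k : ℝ) ≤ convDenom θ (k + 2) := by
    exact_mod_cast two_mul_convDenom_le hθ k
  rw [le_div_iff₀ (by linarith)] at a1
  rw [div_le_iff₀ (by positivity)]
  have e : (convNum θ k * convDenom θ (k + 1) - convDenom θ k * convNum θ (k + 1) : ℝ)
      = convDenom θ k * (convDenom θ (k + 1) * θ - convNum θ (k + 1))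
        - convDenom θ (k + 1) * (convDenom θ k * θ - convNum θ k) := by ring
  rw [e] at hd'
  have t := abs_sub (convDenom θ k * (convDenom θ (k + 1) * θ - convNum θ (k + 1)) : ℝ)
    (convDenom θ (k + 1) * (convDenom θ k * θ - convNum θ k))
  rw [hd', abs_mul, abs_mul, abs_of_pos h0, abs_of_pos h1] at t
  nlinarith [abs_nonneg (convDenom θ (k + 1) * θ - convNum θ (k + 1) : ℝ)]

/-- The first `q_k` multiples of `θ` are `2 / q_k`-dense modulo one. -/
theorem exists_distInt_sub_lt {θ : ℝ} (hθ : Irrational θ) (k : ℕ) (s : ℝ) :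
    ∃ n : ℕ, 1 ≤ n ∧ n ≤ convDenom θ k ∧ distInt (n * θ - s) < 2 / convDenom θ k := by
  have hq := convDenom_pos θ k
  have hq0 : (0 : ℝ) < convDenom θ k := by exact_mod_cast hq
  have hd := conv_determinant hθ k
  set q := convDenom θ k
  set p := convNum θ k
  set m := round (s * q)
  obtain ⟨ε, hε, hεd⟩ : ∃ ε : ℤ, ε * ε = 1 ∧
      p * convDenom θ (k + 1) - q * convNum θ (k + 1) = ε :=
    ⟨_, by rw [← pow_add, ← two_mul, pow_mul]; simp, hd⟩
  -- Modulo `q` the inverse of `p` is `ε q_{k+1}`, so `n = t + 1` modulo `q` solves `n p ≡ m`, where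
  -- `m / q` is the fraction nearest to `s`. The shift by 1 puts `n` in `1, …, q` instead of `0, …,
  -- q - 1`.
  obtain ⟨t, ht⟩ : ∃ t : ℤ, t = ε * convDenom θ (k + 1) * m - 1 := ⟨_, rfl⟩
  have hq' : (0 : ℤ) < q := by exact_mod_cast hq
  obtain ⟨r, hr⟩ : ∃ r : ℕ, (r : ℤ) = t % q :=
    ⟨(t % q).toNat, Int.toNat_of_nonneg (Int.emod_nonneg _ hq'.ne')⟩
  have hrq : r < q := by
    have := Int.emod_lt_of_pos t hq'
    omega
  refine ⟨r + 1, by omega, by omega, ?_⟩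
  obtain ⟨z, hz⟩ : ∃ z : ℤ, ((r + 1 : ℕ) : ℤ) * p = m + q * z := by
    refine ⟨ε * convNum θ (k + 1) * m - (t / q) * p, ?_⟩
    have h1 := Int.emod_add_mul_ediv t q
    rw [← hr] at h1
    push_cast
    linear_combination p * h1 + p * ht + ε * m * hεd + m * hε
  refine (distInt_le _ z).trans_lt ?_
  have hz' : ((r : ℝ) + 1) * p = m + q * z := by exact_mod_cast hz
  have hr1 : ((r : ℝ) + 1) ≤ q := by exact_mod_cast hrq
  have e : (((r + 1 : ℕ) : ℝ) * θ - s - z)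
      = ((r + 1) / q) * (q * θ - p) - (s * q - m) / q := by
    push_cast
    field_simp
    linear_combination hz'
  have h1 : |((r + 1 : ℝ) / q) * (q * θ - p)| ≤ 1 / q := by
    rw [abs_mul, abs_of_nonneg (by positivity)]
    have h2 := abs_convDenom_mul_sub_le hθ k
    have h3 : (1 : ℝ) / convDenom θ (k + 1) ≤ 1 / q := by
      apply one_div_le_one_div_of_le hq0
      exact_mod_cast convDenom_mono θ (Nat.le_succ k)
    calc _ ≤ 1 * (1 / q : ℝ) := by
          gcongr
          · exact (div_le_one hq0).2 hr1
          · exact h2.trans h3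
      _ = _ := one_mul _
  have h2 : |(s * q - m) / q| ≤ (1 / 2) / q := by
    rw [abs_div, abs_of_pos hq0]
    gcongr
    exact abs_sub_round _
  rw [e]
  calc _ ≤ 1 / (q : ℝ) + (1 / 2) / q := (abs_sub _ _).trans (add_le_add h1 h2)
    _ = (3 / 2) / q := by ring
    _ < 2 / q := by gcongr; norm_num

/-! ### Sums over consecutive blocks -/

theorem summable_of_sum_Ico_le {f b : ℕ → ℝ} {u : ℕ → ℕ} (hu : Monotone u)
    (hu' : Filter.Tendsto u Filter.atTop Filter.atTop) (hf : ∀ n, u 0 ≤ n → 0 ≤ f n)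
    (hb : Summable b) (h : ∀ l, ∑ n ∈ Finset.Ico (u l) (u (l + 1)), f n ≤ b l) : Summable f := by
  have hb0 : ∀ l, 0 ≤ b l := fun l =>
    (Finset.sum_nonneg fun n hn => hf n ((hu (Nat.zero_le l)).trans (Finset.mem_Ico.1 hn).1)).trans
      (h l)
  rw [← summable_nat_add_iff (u 0)]
  refine summable_of_sum_range_le (c := ∑' l, b l) (fun n => hf _ (by omega)) fun N => ?_
  obtain ⟨L, hL⟩ := (hu'.eventually_ge_atTop (N + u 0)).exists
  have e : ∀ L, ∑ n ∈ Finset.Ico (u 0) (u L), f n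
      = ∑ l ∈ Finset.range L, ∑ n ∈ Finset.Ico (u l) (u (l + 1)), f n := by
    intro L
    induction L with
    | zero => simp
    | succ L ih =>
      rw [Finset.sum_range_succ, ← ih, Finset.sum_Ico_consecutive _ (hu (Nat.zero_le _))
        (hu (Nat.le_succ _))]
  calc ∑ n ∈ Finset.range N, f (n + u 0) = ∑ n ∈ Finset.Ico (u 0) (N + u 0), f n := by
        rw [Finset.sum_Ico_eq_sum_range]
        simp [add_comm]
    _ ≤ ∑ n ∈ Finset.Ico (u 0) (u L), f n :=
        Finset.sum_le_sum_of_subset_of_nonneg (Finset.Ico_subset_Ico_right hL)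
          fun n hn _ => hf n (Finset.mem_Ico.1 hn).1
    _ ≤ ∑ l ∈ Finset.range L, b l := by rw [e]; exact Finset.sum_le_sum fun l _ => h l
    _ ≤ ∑' l, b l := hb.sum_le_tsum _ fun l _ => hb0 l

theorem Summable.sum_Ico_blocks {f : ℕ → ℝ} {u : ℕ → ℕ} (hu : Monotone u)
    (hf0 : ∀ n, u 0 ≤ n → 0 ≤ f n) (hf : Summable f) :
    Summable fun l => ∑ n ∈ Finset.Ico (u l) (u (l + 1)), f n := by
  have hg : Summable fun n => f (n + u 0) := (summable_nat_add_iff (u 0)).2 hf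
  refine summable_of_sum_range_le (c := ∑' n, f (n + u 0)) (fun l => Finset.sum_nonneg fun n hn =>
    hf0 n ((hu (Nat.zero_le l)).trans (Finset.mem_Ico.1 hn).1)) fun L => ?_
  have e : ∑ l ∈ Finset.range L, ∑ n ∈ Finset.Ico (u l) (u (l + 1)), f n
      = ∑ n ∈ Finset.Ico (u 0) (u L), f n := by
    induction L with
    | zero => simp
    | succ L ih =>
      rw [Finset.sum_range_succ, ih, Finset.sum_Ico_consecutive _ (hu (Nat.zero_le _))
        (hu (Nat.le_succ _))]
  rw [e, Finset.sum_Ico_eq_sum_range]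
  simp only [add_comm (u 0)]
  exact hg.sum_le_tsum _ fun n _ => hf0 _ (by omega)

/-! ### Almost everywhere statements on the circle and on the line -/

theorem ae_real_of_ae_circle {P : UnitAddCircle → Prop} (h : ∀ᵐ x : UnitAddCircle, P x) :
    ∀ᵐ s : ℝ, P (s : UnitAddCircle) := by
  have h1 : ∀ a : ℤ, ∀ᵐ s : ℝ ∂(volume.restrict (Set.Ioc (a : ℝ) (a + 1))),
      P (s : UnitAddCircle) :=
    fun a => by
      have := (UnitAddCircle.measurePreserving_mk (a : ℝ)).quasiMeasurePreserving
      exact this.ae h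
  have h2 := (ae_restrict_iUnion_iff (μ := (volume : Measure ℝ))
    (fun a : ℤ => Set.Ioc (a : ℝ) (a + 1)) (fun s => P (s : UnitAddCircle))).2 h1
  rwa [iUnion_Ioc_intCast, Measure.restrict_univ] at h2

theorem distInt_natCast_mul_sub (n : ℕ) (θ s : ℝ) :
    distInt (n * θ - s) = ‖n • (θ : UnitAddCircle) - (s : UnitAddCircle)‖ := by
  rw [distInt_eq_norm, AddCircle.coe_sub, ← nsmul_eq_mul, AddCircle.coe_nsmul]

theorem distInt_natCast_mul (n : ℕ) (θ : ℝ) :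
    distInt (n * θ) = ‖n • (θ : UnitAddCircle)‖ := by
  rw [distInt_eq_norm, ← nsmul_eq_mul, AddCircle.coe_nsmul]

theorem UnitAddCircle.volume_closedBall_le (x : UnitAddCircle) (r : ℝ) :
    volume (Metric.closedBall x r) ≤ ENNReal.ofReal (2 * r) := by
  rw [AddCircle.volume_closedBall]
  exact ENNReal.ofReal_le_ofReal (min_le_right _ _)

/-! ### Sequences adapted to a number outside `Ω^{(τ)}` -/

/-- For irrational `θ` a failure beyond `N` would place `θ` in `Ω`, the finitely many smaller `n`
being absorbed by a positive minimum. For rational `θ`, multiples of the denominator give distance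
0. -/
theorem exists_large_distInt_lt {τ θ : ℝ} (hθ : θ ∉ omegaSet τ) {c : ℝ} (hc : 0 < c)
    (N : ℕ) : ∃ n : ℕ, 1 ≤ n ∧ N ≤ n ∧ distInt (n * θ) ≤ c / (n : ℝ) ^ τ := by
  by_contra! hcon
  by_cases hirr : Irrational θ
  · apply hθ
    obtain ⟨d, hd0, hd⟩ : ∃ d : ℝ, 0 < d ∧ ∀ n ∈ Finset.Icc 1 N,
        d ≤ distInt (n * θ) * (n : ℝ) ^ τ := by
      by_cases hN : (Finset.Icc 1 N).Nonempty
      · obtain ⟨m, hm, hmin⟩ := Finset.exists_min_image (Finset.Icc 1 N)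
          (fun n : ℕ => distInt (n * θ) * (n : ℝ) ^ τ) hN
        have hm1 : 1 ≤ m := (Finset.mem_Icc.1 hm).1
        refine ⟨_, mul_pos (distInt_pos (hirr.natCast_mul (by omega))) ?_, hmin⟩
        have : (0 : ℝ) < m := by exact_mod_cast hm1
        positivity
      · exact ⟨1, one_pos, fun n hn => (hN ⟨n, hn⟩).elim⟩
    refine ⟨min c d, lt_min hc hd0, fun n hn => ?_⟩
    have hn0 : (0 : ℝ) < n := by exact_mod_cast hn
    rw [div_le_iff₀ (by positivity)]
    rcases le_total N n with h | h
    · have := hcon n hn h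
      rw [div_lt_iff₀ (by positivity)] at this
      exact (min_le_left _ _).trans this.le
    · exact (min_le_right _ _).trans (hd n (Finset.mem_Icc.2 ⟨hn, h⟩))
  · obtain ⟨q, rfl⟩ : ∃ q : ℚ, (q : ℝ) = θ := by simpa [Irrational] using hirr
    have h := hcon (q.den * (N + 1)) (Nat.mul_pos q.den_pos (Nat.succ_pos N))
      ((Nat.le_succ N).trans (Nat.le_mul_of_pos_left _ q.den_pos))
    have h0 : distInt (((q.den * (N + 1) : ℕ) : ℝ) * q) ≤ 0 := by
      refine (distInt_le _ (q.num * (N + 1))).trans_eq ?_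
      have hq : (q.den : ℝ) * q = q.num := by exact_mod_cast q.den_mul_eq_num
      push_cast
      rw [abs_eq_zero]
      linear_combination (N + 1 : ℝ) * hq
    have : 0 ≤ c / ((q.den * (N + 1) : ℕ) : ℝ) ^ τ := by positivity
    linarith

theorem exists_isTsengBase {τ θ : ℝ} (hθ : θ ∉ omegaSet τ) :
    ∃ v : ℕ → ℕ, IsTsengBase τ θ v := by
  have hc : ∀ l : ℕ, (0 : ℝ) < 1 / (2 * ((l : ℝ) + 1) ^ (2 * τ + 2)) := fun l => by positivity
  choose g hg1 hgN hg using fun (l N : ℕ) => exists_large_distInt_lt hθ (hc l) N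
  -- Asking for an index at least `2 * x` enforces the doubling. The recursion starts at 0, so `v l
  -- = w (l - 1)`, matching the `l + 1` in `hc`.
  let w : ℕ → ℕ := fun l => Nat.rec (g 0 0) (fun l x => g (l + 1) (2 * x)) l
  have hw : ∀ l, ∃ N, w l = g l N := by
    rintro (_ | l)
    · exact ⟨0, rfl⟩
    · exact ⟨_, rfl⟩
  have key : ∀ l, 1 ≤ l → ∃ j, l = j + 1 := fun l hl => ⟨l - 1, by omega⟩
  refine ⟨fun l => w (l - 1), ⟨fun l hl => ?_, fun l hl => ?_, fun l hl => ?_⟩⟩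
  · obtain ⟨N, h⟩ := hw (l - 1)
    rw [h]
    exact hg1 _ _
  · obtain ⟨j, rfl⟩ := key l hl
    exact hgN _ _
  · obtain ⟨j, rfl⟩ := key l hl
    obtain ⟨N, h⟩ := hw j
    have := hg j N
    simp only [Nat.add_sub_cancel, h]
    rw [div_div] at this
    exact_mod_cast this

section TsengSequence

variable {τ θ : ℝ} {v : ℕ → ℕ}

theorem IsTsengBase.cast_pos (hv : IsTsengBase τ θ v) {l : ℕ} (hl : 1 ≤ l) : (0 : ℝ) < v l := by
  exact_mod_cast hv.pos l hl

/-- The unrounded index `ℓ^{2τ} v_ℓ^τ` at least doubles. -/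
theorem IsTsengBase.two_mul_le (hv : IsTsengBase τ θ v) (hτ : 1 ≤ τ) {l : ℕ} (hl : 1 ≤ l) :
    2 * ((l : ℝ) ^ (2 * τ) * (v l : ℝ) ^ τ) ≤
      ((l + 1 : ℕ) : ℝ) ^ (2 * τ) * (v (l + 1) : ℝ) ^ τ := by
  have hv0 := hv.cast_pos hl
  have h2 : (2 * v l : ℝ) ≤ v (l + 1) := by exact_mod_cast hv.double l hl
  have h3 : (2 : ℝ) ≤ 2 ^ τ := by
    simpa using Real.rpow_le_rpow_of_exponent_le (by norm_num : (1 : ℝ) ≤ 2) hτ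
  calc 2 * ((l : ℝ) ^ (2 * τ) * (v l : ℝ) ^ τ) ≤ 2 ^ τ * ((l : ℝ) ^ (2 * τ) * (v l : ℝ) ^ τ) := by
        gcongr
    _ = (l : ℝ) ^ (2 * τ) * (2 * v l : ℝ) ^ τ := by
        rw [Real.mul_rpow (by norm_num) hv0.le]; ring
    _ ≤ _ := by
        gcongr
        simp

theorem IsTsengBase.one_le_index (hv : IsTsengBase τ θ v) (hτ : 1 ≤ τ) {l : ℕ} (hl : 1 ≤ l) :
    1 ≤ (l : ℝ) ^ (2 * τ) * (v l : ℝ) ^ τ := by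
  have h1 : (1 : ℝ) ≤ l := by exact_mod_cast hl
  have h2 : (1 : ℝ) ≤ v l := by exact_mod_cast hv.pos l hl
  exact one_le_mul_of_one_le_of_one_le (Real.one_le_rpow h1 (by linarith))
    (Real.one_le_rpow h2 (by linarith))

theorem IsTsengBase.tsengIndex_lt (hv : IsTsengBase τ θ v) (hτ : 1 ≤ τ) {l : ℕ} (hl : 1 ≤ l) :
    tsengIndex τ v l < tsengIndex τ v (l + 1) := by
  have h1 := hv.one_le_index hτ hl
  have h2 := hv.two_mul_le hτ hl
  unfold tsengIndex
  rw [Nat.lt_iff_add_one_le, Nat.le_floor_iff (by linarith)]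
  have := Nat.floor_le (zero_le_one.trans h1)
  push_cast at *
  linarith

theorem IsTsengBase.tsengIndex_strictMono (hv : IsTsengBase τ θ v) (hτ : 1 ≤ τ) :
    StrictMono fun l => tsengIndex τ v (l + 1) :=
  strictMono_nat_of_lt_succ fun l => hv.tsengIndex_lt hτ (Nat.succ_pos l)

theorem IsTsengBase.one_le_tsengIndex (hv : IsTsengBase τ θ v) (hτ : 1 ≤ τ) {l : ℕ}
    (hl : 1 ≤ l) : 1 ≤ tsengIndex τ v l :=
  Nat.le_floor (by exact_mod_cast hv.one_le_index hτ hl)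

theorem IsTsengBase.mono (hv : IsTsengBase τ θ v) {l m : ℕ} (hl : 1 ≤ l) (hlm : l ≤ m) :
    v l ≤ v m := by
  induction m, hlm using Nat.le_induction with
  | base => exact le_rfl
  | succ m hm ih =>
    have := hv.double m (hl.trans hm)
    omega

theorem IsTsengBase.exists_isTsengSeq (hv : IsTsengBase τ θ v) (hτ : 1 ≤ τ) :
    ∃ ψ : ℕ → ℝ, IsTsengSeq τ v ψ := by
  have hu := hv.tsengIndex_strictMono hτ
  have hex : ∀ n : ℕ, ∃ l, n < tsengIndex τ v (l + 1) := fun n =>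
    ⟨n + 1, (Nat.lt_succ_self n).trans_le (hu.le_apply (x := n + 1))⟩
  classical
  -- `L n` is the number of the block containing `n`. It is 0 for `n < u_1`, where the same formula
  -- supplies the unprescribed values and stays monotone.
  let L : ℕ → ℕ := fun n => Nat.find (hex n)
  refine ⟨fun n => 1 / (2 * ((L n : ℝ) + 1) ^ 2 * (v (L n + 1) : ℝ)),
    ⟨⟨fun n _ => ?_, fun m n _ hmn => ?_⟩, fun l hl n h1 h2 => ?_⟩⟩
  · have := hv.cast_pos (Nat.succ_pos (L n))
    positivity
  · have hL : L m ≤ L n := Nat.find_min' _ (hmn.trans_lt (Nat.find_spec (hex n)))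
    have h1 := hv.cast_pos (Nat.succ_pos (L m))
    have h2 : (v (L m + 1) : ℝ) ≤ v (L n + 1) := by
      exact_mod_cast hv.mono (Nat.succ_pos _) (Nat.succ_le_succ hL)
    have h3 : (L m : ℝ) ≤ L n := by exact_mod_cast hL
    apply one_div_le_one_div_of_le (by positivity)
    gcongr
  · have : L n = l := by
      refine le_antisymm (Nat.find_min' _ h2) ?_
      by_contra hlt
      have h3 : n < tsengIndex τ v (L n + 1) := Nat.find_spec (hex n)
      have h4 : L n ≤ l - 1 := by omega
      have h5 := hu.monotone h4
      simp only [Nat.sub_add_cancel hl] at h5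
      omega
    simp only [this]

variable {ψ : ℕ → ℝ}

/-- With `X` the unrounded index at the end of a block, the block has at least `X / 4` terms, each
equal to `1 / (2^τ X)`. Block sums therefore do not tend to 0. -/
theorem IsTsengSeq.powDiverges (hψ : IsTsengSeq τ v ψ) (hv : IsTsengBase τ θ v) (hτ : 1 ≤ τ) :
    PowDiverges τ ψ := by
  intro hsum
  have hsum' : Summable fun n => ψ n ^ τ := (summable_nat_add_iff 1).1 hsum
  have hu := hv.tsengIndex_strictMono hτ
  have hb := hsum'.sum_Ico_blocks hu.monotone fun n hn =>
    (Real.rpow_nonneg (hψ.approxSeq.pos n ((hv.one_le_tsengIndex hτ le_rfl).trans hn)).le _)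
  have hlim := hb.tendsto_atTop_zero
  have hc : (0 : ℝ) < 1 / (4 * 2 ^ τ) := by positivity
  obtain ⟨l, hl⟩ := (hlim.eventually_lt_const hc).exists
  refine absurd hl (not_lt.2 ?_)
  have hl1 : 1 ≤ l + 1 := Nat.succ_pos l
  have e : ∀ n ∈ Finset.Ico (tsengIndex τ v (l + 1)) (tsengIndex τ v (l + 1 + 1)),
      ψ n ^ τ = (1 / (2 * (((l + 1 : ℕ) : ℝ) + 1) ^ 2 * (v (l + 1 + 1) : ℝ))) ^ τ := by
    intro n hn
    rw [hψ.eq (l + 1) hl1 n (Finset.mem_Ico.1 hn).1 (Finset.mem_Ico.1 hn).2]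
  rw [Finset.sum_congr rfl e, Finset.sum_const, Nat.card_Ico, nsmul_eq_mul,
    Nat.cast_sub (hv.tsengIndex_lt hτ hl1).le]
  have h1 := hv.one_le_index hτ hl1
  have h2 := hv.two_mul_le hτ hl1
  have f1 := Nat.floor_le (zero_le_one.trans h1)
  have f2 := Nat.lt_floor_add_one (((l + 1 + 1 : ℕ) : ℝ) ^ (2 * τ) * (v (l + 1 + 1) : ℝ) ^ τ)
  have hv2 := hv.cast_pos (Nat.succ_pos (l + 1))
  -- This absorbs the rounding: `⌊X⌋ > X - 1 ≥ 3X/4`, while `⌊Y⌋ ≤ Y ≤ X/2`.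
  have h4 : (4 : ℝ) ≤ ((l + 1 + 1 : ℕ) : ℝ) ^ (2 * τ) * (v (l + 1 + 1) : ℝ) ^ τ := by
    have g1 : (2 : ℝ) ≤ ((l + 1 + 1 : ℕ) : ℝ) := by push_cast; linarith [Nat.cast_nonneg (α := ℝ) l]
    have g2 : (1 : ℝ) ≤ (v (l + 1 + 1) : ℝ) ^ τ :=
      Real.one_le_rpow (by exact_mod_cast hv.pos _ (Nat.succ_pos _)) (by linarith)
    have g3 : (4 : ℝ) ≤ ((l + 1 + 1 : ℕ) : ℝ) ^ (2 * τ) := by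
      calc (4 : ℝ) = 2 ^ (2 : ℝ) := by norm_num
        _ ≤ 2 ^ (2 * τ) := Real.rpow_le_rpow_of_exponent_le (by norm_num) (by linarith)
        _ ≤ _ := by gcongr
    nlinarith
  have e2 : (1 / (2 * (((l + 1 : ℕ) : ℝ) + 1) ^ 2 * (v (l + 1 + 1) : ℝ))) ^ τ
      = 1 / (2 ^ τ * (((l + 1 + 1 : ℕ) : ℝ) ^ (2 * τ) * (v (l + 1 + 1) : ℝ) ^ τ)) := by
    rw [Real.div_rpow (by norm_num) (by positivity), Real.one_rpow,
      Real.mul_rpow (by positivity) hv2.le, Real.mul_rpow (by norm_num) (by positivity),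
      Real.rpow_mul (by positivity), mul_assoc]
    norm_num
  rw [e2]
  simp only [tsengIndex]
  set X := ((l + 1 + 1 : ℕ) : ℝ) ^ (2 * τ) * (v (l + 1 + 1) : ℝ) ^ τ
  set Y := ((l + 1 : ℕ) : ℝ) ^ (2 * τ) * (v (l + 1) : ℝ) ^ τ
  calc 1 / (4 * 2 ^ τ) = (X / 4) * (1 / (2 ^ τ * X)) := by field_simp
    _ ≤ ((⌊X⌋₊ : ℝ) - ⌊Y⌋₊) * (1 / (2 ^ τ * X)) := by
      gcongr
      linarith

theorem summable_one_div_add_two_sq : Summable fun l : ℕ => 1 / ((l : ℝ) + 2) ^ 2 := by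
  have := (summable_nat_add_iff 2).2 (Real.summable_one_div_nat_pow.2 (by norm_num : 1 < 2))
  simpa using this

/-- The exponents in `IsTsengBase` and `tsengIndex` cancel up to an inverse square. This summable
drift serves both the criterion series and the covering argument. -/
theorem IsTsengBase.mul_distInt_le (hv : IsTsengBase τ θ v) (hτ : 1 ≤ τ) {l n : ℕ}
    (hn : n ≤ tsengIndex τ v (l + 2)) :
    n * distInt (v (l + 2) * θ) ≤ 1 / (2 * ((l : ℝ) + 2) ^ 2) := by
  have h1 := hv.one_le_index hτ (Nat.succ_pos (l + 1))
  have hn' : (n : ℝ) ≤ ((l + 2 : ℕ) : ℝ) ^ (2 * τ) * (v (l + 2) : ℝ) ^ τ :=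
    (Nat.cast_le.2 hn).trans (Nat.floor_le (zero_le_one.trans h1))
  have hv2 := hv.cast_pos (Nat.succ_pos (l + 1))
  calc n * distInt (v (l + 2) * θ)
      ≤ (((l + 2 : ℕ) : ℝ) ^ (2 * τ) * (v (l + 2) : ℝ) ^ τ) *
        (1 / (2 * ((l + 2 : ℕ) : ℝ) ^ (2 * τ + 2) * (v (l + 2) : ℝ) ^ τ)) := by
        gcongr
        · exact distInt_nonneg _
        · exact hv.approx (l + 2) (Nat.succ_pos (l + 1))
    _ = _ := by
        rw [Real.rpow_add (by positivity)]
        have : (0 : ℝ) < v (l + 1 + 1) := hv2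
        push_cast
        rw [Real.rpow_two]
        field_simp

/-- By best approximation the running minimum `β` dominates `‖q_k θ‖` on the `k`-th block. The
resulting bound `∑ min(ψ, β)` no longer mentions convergents and can be regrouped along the `u_ℓ`.
-/
theorem IsTsengSeq.summable_blockSum (hψ : IsTsengSeq τ v ψ) (hv : IsTsengBase τ θ v) (hτ : 1 ≤ τ)
    (hθ : Irrational θ) : Summable (blockSum θ ψ) := by
  classical
  -- `β n` is the minimum of `‖mθ‖` over `1 ≤ m ≤ n`.
  let β : ℕ → ℝ := fun n => if h : 1 ≤ n then
    (Finset.Icc 1 n).inf' ⟨1, Finset.mem_Icc.2 ⟨le_rfl, h⟩⟩ (fun m => distInt (m * θ)) else 0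
  have hβ0 : ∀ n, 0 ≤ β n := by
    intro n
    by_cases h : 1 ≤ n
    · simp only [β, dif_pos h]
      exact (Finset.le_inf'_iff _ _).2 fun m _ => distInt_nonneg _
    · simp [β, h]
  have hβle : ∀ m n, 1 ≤ m → m ≤ n → β n ≤ distInt (m * θ) := by
    intro m n hm hmn
    simp only [β, dif_pos (hm.trans hmn)]
    exact Finset.inf'_le (fun m : ℕ => distInt (m * θ)) (Finset.mem_Icc.2 ⟨hm, hmn⟩)
  have hβge : ∀ k n, 1 ≤ n → n < convDenom θ (k + 1) → distInt (convDenom θ k * θ) ≤ β n := by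
    intro k n hn hnk
    simp only [β, dif_pos hn]
    refine (Finset.le_inf'_iff _ _).2 fun m hm => ?_
    rw [Finset.mem_Icc] at hm
    exact distInt_convDenom_mul_le_distInt hθ k hm.1 (hm.2.trans_lt hnk)
  have hψ0 : ∀ n, 1 ≤ n → 0 ≤ ψ n := fun n hn => (hψ.approxSeq.pos n hn).le
  have hg : Summable fun n => min (ψ n) (β n) := by
    have hu := hv.tsengIndex_strictMono hτ
    refine summable_of_sum_Ico_le hu.monotone hu.tendsto_atTop
      (fun n hn => le_min (hψ0 n ((hv.one_le_tsengIndex hτ le_rfl).trans hn)) (hβ0 n))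
      summable_one_div_add_two_sq fun l => ?_
    set V := v (l + 2)
    have hV : (0 : ℝ) < V := hv.cast_pos (Nat.succ_pos (l + 1))
    -- Fewer than `V` terms precede `V`, where the constant value of `ψ` is used; from `V` on, `β n
    -- ≤ ‖V θ‖`. Each contribution sums to at most half the target.
    have hterm : ∀ n ∈ Finset.Ico (tsengIndex τ v (l + 1)) (tsengIndex τ v (l + 1 + 1)),
        min (ψ n) (β n) ≤ (if n < V then 1 / (2 * ((l : ℝ) + 2) ^ 2 * V) else 0)
          + distInt (V * θ) := by
      intro n hn
      rw [Finset.mem_Ico] at hn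
      split_ifs with h
      · refine (min_le_left _ _).trans ?_
        rw [hψ.eq (l + 1) (Nat.succ_pos l) n hn.1 hn.2]
        have : ((l + 1 : ℕ) : ℝ) + 1 = l + 2 := by push_cast; ring
        rw [this]
        exact le_add_of_nonneg_right (distInt_nonneg _)
      · rw [zero_add]
        exact (min_le_right _ _).trans
          (hβle _ _ (hv.pos _ (Nat.succ_pos (l + 1))) (not_lt.1 h))
    refine (Finset.sum_le_sum hterm).trans ?_
    rw [Finset.sum_add_distrib, Finset.sum_const, Nat.card_Ico, nsmul_eq_mul]
    have h1 : ∑ n ∈ Finset.Ico (tsengIndex τ v (l + 1)) (tsengIndex τ v (l + 1 + 1)),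
        (if n < V then 1 / (2 * ((l : ℝ) + 2) ^ 2 * V) else 0) ≤ 1 / (2 * ((l : ℝ) + 2) ^ 2) := by
      rw [← Finset.sum_filter, Finset.sum_const, nsmul_eq_mul]
      have hcard : (Finset.filter (· < V)
          (Finset.Ico (tsengIndex τ v (l + 1)) (tsengIndex τ v (l + 1 + 1)))).card ≤ V := by
        refine (Finset.card_le_card (t := Finset.range V) fun n hn => ?_).trans_eq
          (Finset.card_range V)
        exact Finset.mem_range.2 (Finset.mem_filter.1 hn).2
      calc _ ≤ (V : ℝ) * (1 / (2 * ((l : ℝ) + 2) ^ 2 * V)) := by gcongr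
        _ = _ := by field_simp
    have h2 := hv.mul_distInt_le hτ (l := l)
      (n := tsengIndex τ v (l + 1 + 1) - tsengIndex τ v (l + 1)) (Nat.sub_le _ _)
    refine (add_le_add h1 h2).trans_eq ?_
    field_simp
    norm_num
  refine Summable.of_nonneg_of_le (fun k => Finset.sum_nonneg fun n hn => ?_) (fun k => ?_)
    (hg.sum_Ico_blocks (convDenom_mono θ) fun n hn =>
      le_min (hψ0 n ((convDenom_pos θ 0).trans hn)) (hβ0 n))
  · exact le_min (hψ0 n ((convDenom_pos θ k).trans (Finset.mem_Ico.1 hn).1)) (distInt_nonneg _)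
  · refine Finset.sum_le_sum fun n hn => ?_
    rw [Finset.mem_Ico] at hn
    exact min_le_min_left _ (hβge k n ((convDenom_pos θ k).trans hn.1) hn.2)

/-- All solutions in one block put `s` in `V = v_{ℓ+1}` balls of radius `1 / ((ℓ+1)² V)`, of total
measure at most `2 / (ℓ+1)²`; Borel–Cantelli finishes. -/
theorem IsTsengSeq.ae_finite_solutions (hψ : IsTsengSeq τ v ψ) (hv : IsTsengBase τ θ v)
    (hτ : 1 ≤ τ) : ∀ᵐ s : ℝ, (solutions θ ψ s).Finite := by
  set α : UnitAddCircle := (θ : UnitAddCircle)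
  let G : ℕ → Set UnitAddCircle := fun l =>
    ⋃ r ∈ Finset.range (v (l + 2)), Metric.closedBall (r • α) (1 / (((l : ℝ) + 2) ^ 2 * v (l + 2)))
  have hG : ∀ l, volume (G l) ≤ ENNReal.ofReal (2 * (1 / ((l : ℝ) + 2) ^ 2)) := by
    intro l
    have hV : (0 : ℝ) < v (l + 2) := hv.cast_pos (Nat.succ_pos (l + 1))
    calc volume (G l) ≤ ∑ r ∈ Finset.range (v (l + 2)), volume
          (Metric.closedBall (r • α) (1 / (((l : ℝ) + 2) ^ 2 * v (l + 2)))) :=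
          measure_biUnion_finset_le _ _
      _ ≤ ∑ r ∈ Finset.range (v (l + 2)),
          ENNReal.ofReal (2 * (1 / (((l : ℝ) + 2) ^ 2 * v (l + 2)))) :=
          Finset.sum_le_sum fun r _ => UnitAddCircle.volume_closedBall_le _ _
      _ = _ := by
          rw [Finset.sum_const, Finset.card_range, ← ENNReal.ofReal_nsmul, nsmul_eq_mul]
          congr 1
          field_simp
  have hfin : ∑' l, volume (G l) ≠ ⊤ := by
    refine ne_top_of_le_ne_top ?_ (ENNReal.tsum_le_tsum hG)
    exact (summable_one_div_add_two_sq.mul_left 2).tsum_ofReal_ne_top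
  have hae := ae_real_of_ae_circle (ae_eventually_notMem hfin)
  filter_upwards [hae] with s hs
  obtain ⟨L, hL⟩ := Filter.eventually_atTop.1 hs
  refine (Set.finite_lt_nat (tsengIndex τ v (L + 1))).subset fun n hn => ?_
  by_contra hlt
  simp only [Set.mem_ofPred_eq, not_lt] at hlt
  have hu := hv.tsengIndex_strictMono hτ
  obtain ⟨l, hl1, hl2⟩ : ∃ l, tsengIndex τ v (l + 1) ≤ n ∧ n < tsengIndex τ v (l + 2) := by
    have hex : ∃ l, n < tsengIndex τ v (l + 1) :=
      ⟨n + 1, (Nat.lt_succ_self n).trans_le (hu.le_apply (x := n + 1))⟩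
    classical
    have h0 : Nat.find hex ≠ 0 := by
      intro h0
      have := Nat.find_spec hex
      rw [h0] at this
      have h1 := hu.monotone (Nat.zero_le L)
      omega
    refine ⟨Nat.find hex - 1, ?_, ?_⟩
    · exact not_lt.1 (Nat.find_min hex (by omega))
    · have := Nat.find_spec hex
      rwa [show Nat.find hex - 1 + 2 = Nat.find hex + 1 by omega]
  have hLl : L ≤ l := by
    by_contra h
    have := hu.monotone (show l + 1 ≤ L by omega)
    change tsengIndex τ v (l + 2) ≤ _ at this
    omega
  apply hL l hLl
  have hV : (0 : ℝ) < v (l + 2) := hv.cast_pos (Nat.succ_pos (l + 1))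
  have hVn : 0 < v (l + 2) := hv.pos _ (Nat.succ_pos (l + 1))
  have hs2 := hn.2
  rw [hψ.eq (l + 1) (Nat.succ_pos l) n hl1 hl2, distInt_natCast_mul_sub] at hs2
  simp only [G, Set.mem_iUnion, exists_prop, Finset.mem_range, Metric.mem_closedBall]
  refine ⟨n % v (l + 2), Nat.mod_lt _ hVn, ?_⟩
  set V := v (l + 2)
  -- Dropping the multiples of `V` moves `n θ` by at most `(n / V) ‖V θ‖`, which is no larger than
  -- the value of `ψ` on the block; hence the doubled radius in `G`.
  have hsplit : n • α = (n % V) • α + (n / V) • (V • α) := by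
    rw [← mul_nsmul, ← add_nsmul, Nat.mod_add_div]
  have hj : ((n / V : ℕ) : ℝ) * ‖V • α‖ ≤ 1 / (2 * ((l : ℝ) + 2) ^ 2 * V) := by
    have h1 := hv.mul_distInt_le hτ hl2.le
    rw [distInt_natCast_mul] at h1
    have h2 : ((n / V : ℕ) : ℝ) ≤ n / V := Nat.cast_div_le
    calc ((n / V : ℕ) : ℝ) * ‖V • α‖ ≤ (n / V) * ‖V • α‖ := by gcongr
      _ = (n * ‖V • α‖) / V := by ring
      _ ≤ (1 / (2 * ((l : ℝ) + 2) ^ 2)) / V := by gcongr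
      _ = _ := by field_simp
  rw [dist_comm, dist_eq_norm]
  have e : (n % V) • α - (s : UnitAddCircle) = (n • α - s) - (n / V) • (V • α) := by
    rw [hsplit]; abel
  have hcast : ((l + 1 : ℕ) : ℝ) + 1 = l + 2 := by push_cast; ring
  rw [hcast] at hs2
  calc _ ≤ ‖n • α - (s : UnitAddCircle)‖ + ‖(n / V) • (V • α)‖ := by rw [e]; exact norm_sub_le _ _
    _ ≤ 1 / (2 * ((l : ℝ) + 2) ^ 2 * V) + 1 / (2 * ((l : ℝ) + 2) ^ 2 * V) :=
        add_le_add hs2.le ((norm_nsmul_le).trans hj)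
    _ = _ := by field_simp; norm_num

end TsengSequence

/-! ### A second moment criterion -/

/-- This is Cauchy–Schwarz for the counting function `N = ∑ 1_{E_l}` and `1_U`: integrate `2 t N ≤
t² N² + 1_U` and optimise at `t = s / Q`. If `Q = 0`, a large `t` forces `s = 0`. -/
theorem sq_sum_measureReal_le {Ω : Type*} [MeasurableSpace Ω] {μ : Measure Ω} [IsFiniteMeasure μ]
    {E : ℕ → Set Ω} (hE : ∀ l, MeasurableSet (E l)) (S : Finset ℕ) :
    (∑ l ∈ S, μ.real (E l)) ^ 2 ≤
      (∑ k ∈ S, ∑ l ∈ S, μ.real (E k ∩ E l)) * μ.real (⋃ l ∈ S, E l) := by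
  set Q := ∑ k ∈ S, ∑ l ∈ S, μ.real (E k ∩ E l)
  set s := ∑ l ∈ S, μ.real (E l)
  set U := ⋃ l ∈ S, E l
  have hU : MeasurableSet U := Finset.measurableSet_biUnion S fun l _ => hE l
  let ind : Set Ω → Ω → ℝ := fun A => A.indicator 1
  have hint : ∀ A : Set Ω, MeasurableSet A → Integrable (ind A) μ := fun A hA =>
    (integrable_indicator_iff hA).2 (integrable_const 1).integrableOn
  have hval : ∀ A : Set Ω, MeasurableSet A → ∫ x, ind A x ∂μ = μ.real A := fun A hA =>
    integral_indicator_one hA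
  have key : ∀ t : ℝ, 2 * t * s ≤ t ^ 2 * Q + μ.real U := by
    intro t
    have h1 : ∫ x, 2 * t * ∑ l ∈ S, ind (E l) x ∂μ = 2 * t * s := by
      rw [integral_const_mul, integral_finsetSum _ fun l _ => hint _ (hE l)]
      simp only [hval _ (hE _), s]
    have i2 : Integrable (fun x => t ^ 2 * ∑ k ∈ S, ∑ l ∈ S, ind (E k ∩ E l) x) μ :=
      (integrable_finsetSum _ fun k _ => integrable_finsetSum _ fun l _ =>
        hint _ ((hE k).inter (hE l))).const_mul _
    have h2 : ∫ x, (t ^ 2 * ∑ k ∈ S, ∑ l ∈ S, ind (E k ∩ E l) x + ind U x) ∂μ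
        = t ^ 2 * Q + μ.real U := by
      rw [integral_add i2 (hint U hU), hval U hU, integral_const_mul,
        integral_finsetSum _ fun k _ => integrable_finsetSum _ fun l _ =>
        hint _ ((hE k).inter (hE l))]
      congr 2
      refine Finset.sum_congr rfl fun k _ => ?_
      rw [integral_finsetSum _ fun l _ => hint _ ((hE k).inter (hE l))]
      exact Finset.sum_congr rfl fun l _ => hval _ ((hE k).inter (hE l))
    rw [← h1, ← h2]
    refine integral_mono ((integrable_finsetSum _ fun l _ => hint _ (hE l)).const_mul _)
      (i2.add (hint U hU)) fun x => ?_
    have e : ∑ k ∈ S, ∑ l ∈ S, ind (E k ∩ E l) x = (∑ l ∈ S, ind (E l) x) ^ 2 := by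
      rw [sq, Finset.sum_mul_sum]
      refine Finset.sum_congr rfl fun k _ => Finset.sum_congr rfl fun l _ => ?_
      by_cases h1 : x ∈ E k <;> by_cases h2 : x ∈ E l <;> simp [ind, h1, h2]
    simp only [e]
    by_cases hx : x ∈ U
    · have : ind U x = 1 := by simp [ind, hx]
      rw [this]
      nlinarith [sq_nonneg (t * ∑ l ∈ S, ind (E l) x - 1)]
    · have h0 : ∑ l ∈ S, ind (E l) x = 0 := by
        refine Finset.sum_eq_zero fun l hl => ?_
        have : x ∉ E l := fun h => hx (Set.mem_biUnion hl h)
        simp [ind, this]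
      have : ind U x = 0 := by simp [ind, hx]
      rw [h0, this]
      simp
  have hQ : 0 ≤ Q := Finset.sum_nonneg fun k _ => Finset.sum_nonneg fun l _ => measureReal_nonneg
  have hs : 0 ≤ s := Finset.sum_nonneg fun k _ => measureReal_nonneg
  rcases hQ.eq_or_lt with h0 | hpos
  · have hs0 : s = 0 := by
      by_contra hne
      have hspos : 0 < s := lt_of_le_of_ne hs (Ne.symm hne)
      have := key ((μ.real U + 1) / s)
      rw [← h0] at this
      have e : 2 * ((μ.real U + 1) / s) * s = 2 * (μ.real U + 1) := by field_simp
      have : 0 ≤ μ.real U := measureReal_nonneg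
      linarith
    rw [hs0, ← h0]
    simp
  · have := key (s / Q)
    have e : 2 * (s / Q) * s = 2 * (s ^ 2 / Q) := by ring
    have e' : (s / Q) ^ 2 * Q = s ^ 2 / Q := by field_simp
    rw [e, e'] at this
    have h3 : s ^ 2 / Q ≤ μ.real U := by linarith
    rw [div_le_iff₀ hpos] at h3
    linarith

/-- On a stretch with `s = ∑ μ(E_l) ≥ 1`, linear terms are absorbed in `s²`, so the pair sum is at
most `(1 + 4C) s²`. Every tail union then has measure at least `1 / (1 + 4C)`, which survives in the
intersection. -/
theorem measure_limsup_pos_of_quasi_independent {Ω : Type*} [MeasurableSpace Ω] {μ : Measure Ω}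
    [IsFiniteMeasure μ] {E : ℕ → Set Ω} (hE : ∀ l, MeasurableSet (E l)) {C : ℝ} (hC : 0 ≤ C)
    (hdiv : ¬ Summable fun l => μ.real (E l))
    (hpair : ∀ m l, ∑ k ∈ Finset.Ico m l, μ.real (E k ∩ E l) ≤
      C * μ.real (E l) * (∑ k ∈ Finset.Ico m l, μ.real (E k) + 1)) :
    0 < μ (Filter.limsup E Filter.atTop) := by
  have hQ : ∀ m d, ∑ k ∈ Finset.Ico m (m + d), ∑ l ∈ Finset.Ico m (m + d), μ.real (E k ∩ E l) ≤
      ∑ l ∈ Finset.Ico m (m + d), μ.real (E l) + 2 * C * (∑ l ∈ Finset.Ico m (m + d), μ.real (E l))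
        * (∑ l ∈ Finset.Ico m (m + d), μ.real (E l) + 1) := by
    intro m d
    induction d with
    | zero => simp
    | succ d ih =>
      have hle : m ≤ m + d := Nat.le_add_right m d
      rw [← Nat.add_assoc]
      simp only [Finset.sum_Ico_succ_top hle, Finset.sum_add_distrib, Set.inter_self]
      have hp := hpair m (m + d)
      have hsymm : ∑ l ∈ Finset.Ico m (m + d), μ.real (E (m + d) ∩ E l)
          = ∑ l ∈ Finset.Ico m (m + d), μ.real (E l ∩ E (m + d)) :=
        Finset.sum_congr rfl fun l _ => by rw [Set.inter_comm]
      rw [hsymm]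
      have hs : 0 ≤ ∑ l ∈ Finset.Ico m (m + d), μ.real (E l) :=
        Finset.sum_nonneg fun _ _ => measureReal_nonneg
      have he : 0 ≤ μ.real (E (m + d)) := measureReal_nonneg
      have := mul_nonneg hC (mul_nonneg hs he)
      have := mul_nonneg hC (mul_nonneg he he)
      nlinarith
  have hbound : ∀ m, 1 / (1 + 4 * C) ≤ μ.real (⋃ l ≥ m, E l) := by
    intro m
    have hdiv' : ¬ Summable fun l => μ.real (E (l + m)) := by
      rwa [summable_nat_add_iff (f := fun l => μ.real (E l)) m]
    obtain ⟨d, hd⟩ : ∃ d, 1 ≤ ∑ l ∈ Finset.Ico m (m + d), μ.real (E l) := by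
      by_contra! hcon
      refine hdiv' (summable_of_sum_range_le (c := 1) (fun _ => measureReal_nonneg) fun d => ?_)
      have := (hcon d).le
      rw [Finset.sum_Ico_eq_sum_range] at this
      simpa [add_comm] using this
    have h1 := sq_sum_measureReal_le (μ := μ) hE (Finset.Ico m (m + d))
    have h2 := hQ m d
    set s := ∑ l ∈ Finset.Ico m (m + d), μ.real (E l)
    have hU : μ.real (⋃ l ∈ Finset.Ico m (m + d), E l) ≤ μ.real (⋃ l ≥ m, E l) := by
      refine measureReal_mono ?_ (measure_ne_top _ _)
      exact Set.biUnion_mono (fun l hl => (Finset.mem_Ico.1 hl).1) fun _ _ => subset_rfl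
    have h3 : s + 2 * C * s * (s + 1) ≤ (1 + 4 * C) * s ^ 2 := by
      have : 0 ≤ C * (s * (s - 1)) := by
        have : 0 ≤ s - 1 := by linarith
        positivity
      nlinarith
    have h4 : s ^ 2 ≤ s ^ 2 * ((1 + 4 * C) * μ.real (⋃ l ≥ m, E l)) := by
      calc s ^ 2 ≤ _ := h1
        _ ≤ ((1 + 4 * C) * s ^ 2) * μ.real (⋃ l ≥ m, E l) := by
            gcongr
            exact h2.trans h3
        _ = _ := by ring
    rw [div_le_iff₀ (by positivity)]
    have h5 : (0 : ℝ) < s ^ 2 := by positivity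
    nlinarith
  have hlim : Filter.Tendsto (fun m => μ (⋃ l ≥ m, E l)) Filter.atTop
      (nhds (μ (⋂ m, ⋃ l ≥ m, E l))) := by
    refine tendsto_measure_iInter_atTop
      (fun m => (MeasurableSet.biUnion (Set.to_countable _) fun l _ => hE l).nullMeasurableSet)
      (fun a b hab => ?_) ⟨0, measure_ne_top _ _⟩
    exact Set.biUnion_mono (fun l (hl : b ≤ l) => le_trans hab hl) fun _ _ => subset_rfl
  rw [Filter.limsup_eq_iInf_iSup_of_nat]
  simp only [Set.iInf_eq_iInter, Set.iSup_eq_iUnion]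
  have hpos : (0 : ENNReal) < ENNReal.ofReal (1 / (1 + 4 * C)) :=
    ENNReal.ofReal_pos.2 (by positivity)
  refine hpos.trans_le (ge_of_tendsto' hlim fun m => ?_)
  exact (ENNReal.ofReal_le_iff_le_toReal (measure_ne_top _ _)).2 (hbound m)

/-! ### Balls on the circle -/

theorem UnitAddCircle.measureReal_ball (x : UnitAddCircle) {r : ℝ} (h0 : 0 < r) (h1 : 2 * r ≤ 1) :
    volume.real (Metric.ball x r) = 2 * r := by
  have h : volume (Metric.ball x r) = volume (Metric.closedBall x r) :=
    (measure_congr (AddCircle.closedBall_ae_eq_ball)).symm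
  rw [measureReal_def, h, AddCircle.volume_closedBall, min_eq_right h1,
    ENNReal.toReal_ofReal (by linarith)]

theorem UnitAddCircle.measureReal_closedBall_le (x : UnitAddCircle) {r : ℝ} (h0 : 0 ≤ r) :
    volume.real (Metric.closedBall x r) ≤ 2 * r :=
  ENNReal.toReal_le_of_le_ofReal (by linarith) (UnitAddCircle.volume_closedBall_le x r)

/-- A `d`-separated set of points in a ball of radius `ρ` has at most `2ρ/d + 1` elements. -/
theorem UnitAddCircle.card_mul_le {ι : Type*} (S : Finset ι) (x : ι → UnitAddCircle)
    (y : UnitAddCircle) {d ρ : ℝ} (hd : 0 < d) (hd1 : d ≤ 1) (hρ : 0 ≤ ρ)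
    (hsep : ∀ i ∈ S, ∀ j ∈ S, i ≠ j → d ≤ ‖x i - x j‖) (hin : ∀ i ∈ S, ‖x i - y‖ ≤ ρ) :
    S.card * d ≤ 2 * ρ + d := by
  have hdisj : Set.PairwiseDisjoint (S : Set ι) fun i => Metric.ball (x i) (d / 2) := by
    intro i hi j hj hij
    refine Metric.ball_disjoint_ball ?_
    rw [dist_eq_norm]
    linarith [hsep i hi j hj hij]
  have h1 := measureReal_biUnion_finset (μ := (volume : Measure UnitAddCircle)) hdisj
    fun i _ => Metric.isOpen_ball.measurableSet
  simp only [UnitAddCircle.measureReal_ball _ (half_pos hd) (by linarith : 2 * (d / 2) ≤ 1),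
    Finset.sum_const, nsmul_eq_mul] at h1
  have h2 : (⋃ i ∈ S, Metric.ball (x i) (d / 2)) ⊆ Metric.closedBall y (ρ + d / 2) := by
    refine Set.iUnion₂_subset fun i hi z hz => ?_
    rw [Metric.mem_ball] at hz
    rw [Metric.mem_closedBall]
    have := hin i hi
    rw [← dist_eq_norm] at this
    linarith [dist_triangle z (x i) y]
  have h3 := (measureReal_mono (μ := (volume : Measure UnitAddCircle)) h2).trans
    (UnitAddCircle.measureReal_closedBall_le y (by positivity))
  rw [h1] at h3
  linarith

/-! ### The blocks of balls -/

theorem norm_nsmul_sub_nsmul_ge {θ : ℝ} (hθ : Irrational θ) (k : ℕ) {m n : ℕ} (hmn : m ≠ n)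
    (h1 : m < n + convDenom θ (k + 1)) (h2 : n < m + convDenom θ (k + 1)) :
    1 / (2 * convDenom θ (k + 1)) ≤
      ‖m • (θ : UnitAddCircle) - n • (θ : UnitAddCircle)‖ := by
  wlog h : n < m generalizing m n
  · rw [norm_sub_rev]
    exact this hmn.symm h2 h1 (by omega)
  rw [sub_eq_add_neg, ← sub_nsmul _ h.le, ← distInt_natCast_mul]
  exact one_div_le_distInt hθ k (by omega) (by omega)

/-- Since `q_{l+2} ≥ 2 q_l`, denominators of each parity grow geometrically. -/
theorem sum_convDenom_le {θ : ℝ} (hθ : Irrational θ) (l : ℕ) :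
    ∑ k ∈ Finset.range (l + 1), convDenom θ k ≤ 4 * convDenom θ l := by
  induction l using Nat.twoStepInduction with
  | zero => simp; omega
  | one =>
    have : convDenom θ 0 ≤ convDenom θ 1 := convDenom_mono θ (Nat.le_succ 0)
    simp [Finset.sum_range_succ]
    omega
  | more l ih _ =>
    rw [Finset.sum_range_succ, Finset.sum_range_succ]
    have := two_mul_convDenom_le hθ l
    have : convDenom θ (l + 1) ≤ convDenom θ (l + 2) := convDenom_mono θ (Nat.le_succ _)
    omega

/-- The radius of the balls in the `j`-th run of `q_l` consecutive multiples of `θ`. -/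
noncomputable def runRadius (θ : ℝ) (ψ : ℕ → ℝ) (l j : ℕ) : ℝ :=
  min (ψ ((j + 1) * convDenom θ l)) (1 / (4 * convDenom θ (l + 1)))

/-- Indices `(j, i)` of the multiples `j q_l + i + 1` of `θ` forming the `l`-th block. -/
noncomputable def blockIndex (θ : ℝ) (l : ℕ) : Finset (ℕ × ℕ) :=
  Finset.range (convDenom θ (l + 1) / convDenom θ l) ×ˢ Finset.range (convDenom θ l)

/-- The multiple of `θ` with index `(j, i)` in the `l`-th block. -/
noncomputable def blockPoint (θ : ℝ) (l : ℕ) (x : ℕ × ℕ) : ℕ := x.1 * convDenom θ l + x.2 + 1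

/-- The union of the balls of the `l`-th block. -/
noncomputable def blockSet (θ : ℝ) (ψ : ℕ → ℝ) (l : ℕ) : Set UnitAddCircle :=
  ⋃ x ∈ blockIndex θ l,
    Metric.ball (blockPoint θ l x • (θ : UnitAddCircle)) (runRadius θ ψ l x.1)

theorem blockPoint_le_run {θ : ℝ} {l : ℕ} {x : ℕ × ℕ} (hx : x ∈ blockIndex θ l) :
    blockPoint θ l x ≤ (x.1 + 1) * convDenom θ l := by
  have h2 : x.2 < convDenom θ l := Finset.mem_range.1 (Finset.mem_product.1 hx).2
  rw [blockPoint, Nat.add_mul, one_mul]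
  omega

theorem blockPoint_le {θ : ℝ} {l : ℕ} {x : ℕ × ℕ} (hx : x ∈ blockIndex θ l) :
    blockPoint θ l x ≤ convDenom θ (l + 1) := by
  have h1 : x.1 < convDenom θ (l + 1) / convDenom θ l :=
    Finset.mem_range.1 (Finset.mem_product.1 hx).1
  exact (blockPoint_le_run hx).trans
    ((Nat.mul_le_mul_right _ h1).trans (Nat.div_mul_le_self _ _))

theorem blockPoint_injOn (θ : ℝ) (l : ℕ) : Set.InjOn (blockPoint θ l) (blockIndex θ l) := by
  intro x hx y hy hxy
  have hx2 : x.2 < convDenom θ l := Finset.mem_range.1 (Finset.mem_product.1 hx).2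
  have hy2 : y.2 < convDenom θ l := Finset.mem_range.1 (Finset.mem_product.1 hy).2
  have e : x.2 + convDenom θ l * x.1 = y.2 + convDenom θ l * y.1 := by
    simp only [blockPoint] at hxy
    rw [mul_comm _ x.1, mul_comm _ y.1]
    omega
  have hq : 0 < convDenom θ l := convDenom_pos θ l
  have e1 : x.1 = y.1 := by
    have := congrArg (· / convDenom θ l) e
    simpa [Nat.add_mul_div_left _ _ hq, Nat.div_eq_of_lt hx2, Nat.div_eq_of_lt hy2] using this
  refine Prod.ext e1 ?_
  rw [e1] at e
  omega

theorem card_blockIndex_le (θ : ℝ) (l : ℕ) : (blockIndex θ l).card ≤ convDenom θ (l + 1) := by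
  rw [blockIndex, Finset.card_product, Finset.card_range, Finset.card_range]
  exact Nat.div_mul_le_self _ _

section Blocks

variable {θ : ℝ} {ψ : ℕ → ℝ}

theorem convDenom_cast_pos (θ : ℝ) (l : ℕ) : (0 : ℝ) < convDenom θ l := by
  exact_mod_cast convDenom_pos θ l

theorem runRadius_pos (hψ : IsApproxSeq ψ) (l j : ℕ) : 0 < runRadius θ ψ l j := by
  have := convDenom_cast_pos θ (l + 1)
  exact lt_min (hψ.pos _ (Nat.mul_pos (Nat.succ_pos j) (convDenom_pos θ l))) (by positivity)

theorem runRadius_le (θ : ℝ) (ψ : ℕ → ℝ) (l j : ℕ) :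
    runRadius θ ψ l j ≤ 1 / (4 * convDenom θ (l + 1)) := min_le_right _ _

theorem measureReal_run_ball (hψ : IsApproxSeq ψ) (l j : ℕ) (x : UnitAddCircle) :
    volume.real (Metric.ball x (runRadius θ ψ l j)) = 2 * runRadius θ ψ l j := by
  refine UnitAddCircle.measureReal_ball x (runRadius_pos hψ l j) ?_
  have h := runRadius_le θ ψ l j
  have h1 : (1 : ℝ) ≤ convDenom θ (l + 1) := by exact_mod_cast convDenom_pos θ (l + 1)
  have : (1 : ℝ) / (4 * convDenom θ (l + 1)) ≤ 1 / 4 :=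
    one_div_le_one_div_of_le (by norm_num) (by linarith)
  linarith

theorem measurableSet_blockSet (θ : ℝ) (ψ : ℕ → ℝ) (l : ℕ) : MeasurableSet (blockSet θ ψ l) :=
  Finset.measurableSet_biUnion _ fun _ _ => Metric.isOpen_ball.measurableSet

/-- The cap on the radii is half the separation `1/(2 q_{l+1})` of the first `q_{l+1}` multiples, so
the balls are disjoint. -/
theorem measureReal_blockSet (hθ : Irrational θ) (hψ : IsApproxSeq ψ) (l : ℕ) :
    volume.real (blockSet θ ψ l) = ∑ x ∈ blockIndex θ l, 2 * runRadius θ ψ l x.1 := by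
  rw [blockSet, measureReal_biUnion_finset ?_ fun _ _ => Metric.isOpen_ball.measurableSet]
  · exact Finset.sum_congr rfl fun x _ => measureReal_run_ball hψ l _ _
  · intro x hx y hy hxy
    refine Metric.ball_disjoint_ball ?_
    have hne : blockPoint θ l x ≠ blockPoint θ l y := fun h => hxy (blockPoint_injOn θ l hx hy h)
    have h1 := blockPoint_le hx
    have h2 := blockPoint_le hy
    have h3 := norm_nsmul_sub_nsmul_ge hθ l hne (by rw [blockPoint, blockPoint] at *; omega)
      (by rw [blockPoint, blockPoint] at *; omega)
    rw [dist_eq_norm]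
    have e : (1 : ℝ) / (2 * convDenom θ (l + 1)) = 2 * (1 / (4 * convDenom θ (l + 1))) := by
      have := convDenom_cast_pos θ (l + 1)
      field_simp
      norm_num
    linarith [runRadius_le θ ψ l x.1, runRadius_le θ ψ l y.1]

theorem measureReal_blockSet' (hθ : Irrational θ) (hψ : IsApproxSeq ψ) (l : ℕ) :
    volume.real (blockSet θ ψ l) = convDenom θ l *
      ∑ j ∈ Finset.range (convDenom θ (l + 1) / convDenom θ l), 2 * runRadius θ ψ l j := by
  rw [measureReal_blockSet hθ hψ, blockIndex, Finset.sum_product]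
  simp [Finset.mul_sum]

/-- Fix a ball of block `k`, of radius `r`, and a run of block `l`. The run's centres are `1/(2
q_l)`-separated, so at most `4 q_l r + 2` of its balls meet the fixed one. Summing, the first term
gives the product of measures; the 2, over at most `q_{k+1}` balls, gives the error `q_{k+1} / q_l`.
-/
theorem measureReal_blockSet_inter_le (hθ : Irrational θ) (hψ : IsApproxSeq ψ) {k l : ℕ}
    (hkl : k < l) :
    volume.real (blockSet θ ψ k ∩ blockSet θ ψ l) ≤ volume.real (blockSet θ ψ l) *
      (2 * volume.real (blockSet θ ψ k) + 2 * (convDenom θ (k + 1) / convDenom θ l)) := by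
  classical
  set α : UnitAddCircle := (θ : UnitAddCircle)
  set q : ℝ := (convDenom θ l : ℝ)
  have hq : 0 < q := convDenom_cast_pos θ l
  have hq1 : 1 ≤ q := Nat.one_le_cast.2 (convDenom_pos θ l)
  set J := Finset.range (convDenom θ (l + 1) / convDenom θ l)
  let F : ℕ × ℕ → ℕ → Finset ℕ := fun x j => (Finset.range (convDenom θ l)).filter fun i =>
    ‖blockPoint θ l (j, i) • α - blockPoint θ k x • α‖ ≤ runRadius θ ψ k x.1 + runRadius θ ψ l j
  have hsub : blockSet θ ψ k ∩ blockSet θ ψ l ⊆ ⋃ x ∈ blockIndex θ k, ⋃ j ∈ J, ⋃ i ∈ F x j,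
      Metric.ball (blockPoint θ l (j, i) • α) (runRadius θ ψ l j) := by
    rintro z ⟨hz1, hz2⟩
    simp only [blockSet, Set.mem_iUnion, exists_prop] at hz1 hz2 ⊢
    obtain ⟨x, hx, hzx⟩ := hz1
    obtain ⟨⟨j, i⟩, hji, hzji⟩ := hz2
    obtain ⟨hj, hi⟩ := Finset.mem_product.1 hji
    refine ⟨x, hx, j, hj, i, Finset.mem_filter.2 ⟨hi, ?_⟩, hzji⟩
    rw [Metric.mem_ball] at hzx hzji
    rw [← dist_eq_norm]
    have := dist_triangle_left (blockPoint θ l (j, i) • α) (blockPoint θ k x • α) z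
    linarith
  have hF : ∀ x j, ((F x j).card : ℝ) ≤ 4 * q * runRadius θ ψ k x.1 + 2 := by
    intro x j
    have hrx := runRadius_pos (θ := θ) hψ k x.1
    have hrj := runRadius_pos (θ := θ) hψ l j
    have hd0 : (0 : ℝ) < 1 / (2 * q) := by positivity
    have hd1 : 1 / (2 * q) ≤ 1 := by rw [div_le_one (by positivity)]; linarith
    have h := UnitAddCircle.card_mul_le (F x j) (fun i => blockPoint θ l (j, i) • α)
      (blockPoint θ k x • α) hd0 hd1 (add_pos hrx hrj).le (fun i hi i' hi' hne => ?_)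
      (fun i hi => (Finset.mem_filter.1 hi).2)
    -- The run's own radius costs at most 1, since it is at most `1/(4 q_{l+1}) ≤ 1/(4 q_l)`. With
    -- the 1 from packing this makes the 2.
    · have hj : 4 * q * runRadius θ ψ l j ≤ 1 := by
        have h1 : q ≤ convDenom θ (l + 1) := Nat.cast_le.2 (convDenom_mono θ (Nat.le_succ l))
        have h2 := runRadius_le θ ψ l j
        rw [le_div_iff₀ (by have := convDenom_cast_pos θ (l + 1); positivity)] at h2
        nlinarith
      have h' := mul_le_mul_of_nonneg_right h (by positivity : 0 ≤ 2 * q)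
      have e1 : ((F x j).card : ℝ) * (1 / (2 * q)) * (2 * q) = (F x j).card := by field_simp
      have e2 : (2 * (runRadius θ ψ k x.1 + runRadius θ ψ l j) + 1 / (2 * q)) * (2 * q)
          = 4 * q * runRadius θ ψ k x.1 + 4 * q * runRadius θ ψ l j + 1 := by field_simp; ring
      rw [e1, e2] at h'
      linarith
    · obtain ⟨l', rfl⟩ : ∃ l', l = l' + 1 := ⟨l - 1, by omega⟩
      have h1 := Finset.mem_range.1 (Finset.mem_filter.1 hi).1
      have h2 := Finset.mem_range.1 (Finset.mem_filter.1 hi').1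
      exact norm_nsmul_sub_nsmul_ge hθ l' (by simp only [blockPoint]; omega)
        (by simp only [blockPoint]; omega) (by simp only [blockPoint]; omega)
  have hstep : volume.real (blockSet θ ψ k ∩ blockSet θ ψ l) ≤
      ∑ x ∈ blockIndex θ k, ∑ j ∈ J,
        (4 * q * runRadius θ ψ k x.1 + 2) * (2 * runRadius θ ψ l j) := by
    refine (measureReal_mono hsub (measure_ne_top _ _)).trans ((measureReal_biUnion_finset_le _ _).trans ?_)
    refine Finset.sum_le_sum fun x _ => (measureReal_biUnion_finset_le _ _).trans ?_
    refine Finset.sum_le_sum fun j _ => (measureReal_biUnion_finset_le _ _).trans ?_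
    rw [Finset.sum_congr rfl fun i _ => measureReal_run_ball hψ l j _, Finset.sum_const,
      nsmul_eq_mul]
    exact mul_le_mul_of_nonneg_right (hF x j) (by have := runRadius_pos (θ := θ) hψ l j; positivity)
  refine hstep.trans ?_
  rw [← Finset.sum_mul_sum, Finset.sum_add_distrib, Finset.sum_const, nsmul_eq_mul]
  have hk : ∑ x ∈ blockIndex θ k, 4 * q * runRadius θ ψ k x.1
      = 2 * q * volume.real (blockSet θ ψ k) := by
    rw [measureReal_blockSet hθ hψ, Finset.mul_sum]
    exact Finset.sum_congr rfl fun x _ => by ring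
  rw [hk, measureReal_blockSet' hθ hψ l]
  have hJ : 0 ≤ ∑ j ∈ J, 2 * runRadius θ ψ l j := Finset.sum_nonneg fun j _ => by
    have := runRadius_pos (θ := θ) hψ l j
    positivity
  have hcard : ((blockIndex θ k).card : ℝ) ≤ convDenom θ (k + 1) := by
    exact_mod_cast card_blockIndex_le θ k
  calc _ ≤ (2 * q * volume.real (blockSet θ ψ k) + convDenom θ (k + 1) * 2) *
        ∑ j ∈ J, 2 * runRadius θ ψ l j := by gcongr
    _ = _ := by
      change _ = q * (∑ j ∈ J, 2 * runRadius θ ψ l j) * _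
      field_simp

theorem volume_limsup_blockSet_pos (hθ : Irrational θ) (hψ : IsApproxSeq ψ)
    (hdiv : ¬ Summable fun l => volume.real (blockSet θ ψ l)) :
    0 < volume (Filter.limsup (blockSet θ ψ) Filter.atTop) := by
  -- The errors `q_{k+1} / q_l` over `k < l` add up to at most 4, and `8 = 2 * 4`.
  refine measure_limsup_pos_of_quasi_independent (measurableSet_blockSet θ ψ)
    (by norm_num : (0 : ℝ) ≤ 8) hdiv fun m l => ?_
  have hq := convDenom_cast_pos θ l
  have h1 : ∑ k ∈ Finset.Ico m l, ((convDenom θ (k + 1) : ℝ) / convDenom θ l) ≤ 4 := by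
    rw [← Finset.sum_div, div_le_iff₀ hq]
    have h2 : ∑ k ∈ Finset.Ico m l, convDenom θ (k + 1) ≤ 4 * convDenom θ l := by
      refine le_trans ?_ (sum_convDenom_le hθ l)
      rw [Finset.sum_range_succ']
      refine le_trans (Finset.sum_le_sum_of_subset fun k hk => ?_) (Nat.le_add_right _ _)
      exact Finset.mem_range.2 (Finset.mem_Ico.1 hk).2
    exact_mod_cast h2
  have he : 0 ≤ volume.real (blockSet θ ψ l) := measureReal_nonneg
  have hs : 0 ≤ ∑ k ∈ Finset.Ico m l, volume.real (blockSet θ ψ k) :=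
    Finset.sum_nonneg fun _ _ => measureReal_nonneg
  calc _ ≤ ∑ k ∈ Finset.Ico m l, volume.real (blockSet θ ψ l) *
        (2 * volume.real (blockSet θ ψ k) + 2 * (convDenom θ (k + 1) / convDenom θ l)) :=
        Finset.sum_le_sum fun k hk =>
          measureReal_blockSet_inter_le hθ hψ (Finset.mem_Ico.1 hk).2
    _ = volume.real (blockSet θ ψ l) * (2 * ∑ k ∈ Finset.Ico m l, volume.real (blockSet θ ψ k)
        + 2 * ∑ k ∈ Finset.Ico m l, ((convDenom θ (k + 1) : ℝ) / convDenom θ l)) := by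
        rw [← Finset.mul_sum, Finset.sum_add_distrib, Finset.mul_sum, Finset.mul_sum]
    _ ≤ volume.real (blockSet θ ψ l) *
        (8 * (∑ k ∈ Finset.Ico m l, volume.real (blockSet θ ψ k) + 1)) := by
        gcongr
        linarith
    _ = _ := by ring

end Blocks

/-! ### Approximable points on the circle -/

/-- The points of the circle within `ψ n` of the `n`-th multiple of `θ`, for `n ≥ 1`. -/
def approxBall (θ : ℝ) (ψ : ℕ → ℝ) (n : ℕ) : Set UnitAddCircle :=
  {x | 1 ≤ n ∧ ‖n • (θ : UnitAddCircle) - x‖ < ψ n}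

theorem measurableSet_approxBall (θ : ℝ) (ψ : ℕ → ℝ) (n : ℕ) :
    MeasurableSet (approxBall θ ψ n) := by
  have h : IsOpen {x : UnitAddCircle | ‖n • (θ : UnitAddCircle) - x‖ < ψ n} :=
    isOpen_lt (by fun_prop) continuous_const
  exact (MeasurableSet.const _).inter h.measurableSet

theorem mem_limsup_approxBall {θ : ℝ} {ψ : ℕ → ℝ} {x : UnitAddCircle} :
    x ∈ Filter.limsup (approxBall θ ψ) Filter.atTop ↔ {n | x ∈ approxBall θ ψ n}.Infinite := by
  rw [Filter.mem_limsup_iff_frequently_mem, Nat.frequently_atTop_iff_infinite]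

section

variable {θ : ℝ} {ψ : ℕ → ℝ}

theorem addOrderOf_coe_eq_zero (hθ : Irrational θ) : addOrderOf (θ : UnitAddCircle) = 0 := by
  rw [addOrderOf_eq_zero_iff']
  intro n hn h
  have h1 := distInt_pos (hθ.natCast_mul (m := n) (by omega))
  rw [distInt_natCast_mul, h, norm_zero] at h1
  exact lt_irrefl _ h1

/-- The zero-one law for the set of approximable points. -/
theorem ae_mem_limsup_approxBall (hθ : Irrational θ) (hψ : IsApproxSeq ψ)
    (hpos : 0 < volume (Filter.limsup (approxBall θ ψ) Filter.atTop)) :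
    ∀ᵐ x : UnitAddCircle, x ∈ Filter.limsup (approxBall θ ψ) Filter.atTop := by
  have herg : Ergodic (fun x : UnitAddCircle => x + -(θ : UnitAddCircle)) volume :=
    AddCircle.ergodic_add_right.2 (by rw [addOrderOf_neg]; exact addOrderOf_coe_eq_zero hθ)
  have hmeas : MeasurableSet (Filter.limsup (approxBall θ ψ) Filter.atTop) :=
    MeasurableSet.measurableSet_limsup (measurableSet_approxBall θ ψ)
  -- Subtracting `θ` turns an approximation by `(c + 1) θ` into one by `c θ`, allowed because `ψ` is
  -- non-increasing. Ergodicity needs only this one inclusion; `a + 2` below keeps `c ≥ 1`.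
  have hsub : Filter.limsup (approxBall θ ψ) Filter.atTop ⊆
      (fun x : UnitAddCircle => x + -(θ : UnitAddCircle)) ⁻¹'
        Filter.limsup (approxBall θ ψ) Filter.atTop := by
    intro x hx
    rw [Set.mem_preimage]
    rw [Filter.mem_limsup_iff_frequently_mem, Filter.frequently_atTop] at hx ⊢
    intro a
    obtain ⟨b, hb, hb1, hb2⟩ := hx (a + 2)
    obtain ⟨c, rfl⟩ : ∃ c, b = c + 1 := ⟨b - 1, by omega⟩
    refine ⟨c, by omega, by omega, ?_⟩
    have e : c • (θ : UnitAddCircle) - (x + -(θ : UnitAddCircle))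
        = (c + 1) • (θ : UnitAddCircle) - x := by rw [succ_nsmul]; abel
    rw [e]
    exact hb2.trans_le (hψ.anti c (c + 1) (by omega) (Nat.le_succ c))
  rcases herg.ae_empty_or_univ_of_ae_le_preimage hmeas.nullMeasurableSet
    (Filter.Eventually.of_forall hsub) with h | h
  · rw [measure_congr h] at hpos
    simp at hpos
  · exact Filter.eventuallyEq_univ.1 h

theorem ae_ne_nsmul (θ : ℝ) : ∀ᵐ x : UnitAddCircle, ∀ n : ℕ, n • (θ : UnitAddCircle) ≠ x := by
  rw [ae_all_iff]
  intro n
  have h : volume ({n • (θ : UnitAddCircle)} : Set UnitAddCircle) = 0 := by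
    rw [← Metric.closedBall_zero, AddCircle.volume_closedBall]
    simp
  refine measure_mono_null (fun x hx => ?_) h
  simpa using Eq.symm (not_not.1 hx)

/-- A point off the orbit that is approximated arbitrarily well is approximated infinitely often. -/
theorem mem_limsup_approxBall_of_frequently (hθ : Irrational θ) {x : UnitAddCircle}
    (hx : ∀ n : ℕ, n • (θ : UnitAddCircle) ≠ x)
    (h : ∃ᶠ l in Filter.atTop, ∃ n, x ∈ approxBall θ ψ n ∧
      ‖n • (θ : UnitAddCircle) - x‖ < 2 / convDenom θ l) :
    x ∈ Filter.limsup (approxBall θ ψ) Filter.atTop := by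
  rw [mem_limsup_approxBall]
  intro hfin
  have hlim : Filter.Tendsto (fun l => (2 : ℝ) / convDenom θ l) Filter.atTop (nhds 0) :=
    (tendsto_natCast_atTop_atTop.comp (convDenom_tendsto hθ)).const_div_atTop 2
  have hev : ∀ᶠ l in Filter.atTop, ∀ n ∈ {n | x ∈ approxBall θ ψ n},
      (2 : ℝ) / convDenom θ l < ‖n • (θ : UnitAddCircle) - x‖ :=
    (Filter.eventually_all_finite hfin).2 fun n _ =>
      hlim.eventually_lt_const (norm_pos_iff.2 (sub_ne_zero.2 (hx n)))
  obtain ⟨l, ⟨n, hn, hlt⟩, hall⟩ := (h.and_eventually hev).exists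
  exact lt_asymm hlt (hall n hn)

theorem mem_limsup_of_frequently_large (hθ : Irrational θ) (hψ : IsApproxSeq ψ)
    (h : ∃ᶠ l in Filter.atTop, 2 / (convDenom θ l : ℝ) ≤ ψ (convDenom θ l)) {x : UnitAddCircle}
    (hx : ∀ n : ℕ, n • (θ : UnitAddCircle) ≠ x) :
    x ∈ Filter.limsup (approxBall θ ψ) Filter.atTop := by
  refine mem_limsup_approxBall_of_frequently hθ hx (h.mono fun l hl => ?_)
  obtain ⟨s, rfl⟩ := QuotientAddGroup.mk_surjective x
  obtain ⟨n, hn1, hn2, hn3⟩ := exists_distInt_sub_lt hθ l s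
  rw [distInt_natCast_mul_sub] at hn3
  exact ⟨n, ⟨hn1, hn3.trans_le (hl.trans (hψ.anti _ _ hn1 hn2))⟩, hn3⟩

/-- Every block starts again at the first multiple, so one `n` could serve infinitely many blocks.
Shrinking radii exclude this off the orbit. -/
theorem mem_limsup_of_mem_limsup_blockSet (hθ : Irrational θ) (hψ : IsApproxSeq ψ)
    {x : UnitAddCircle} (hx : ∀ n : ℕ, n • (θ : UnitAddCircle) ≠ x)
    (h : x ∈ Filter.limsup (blockSet θ ψ) Filter.atTop) :
    x ∈ Filter.limsup (approxBall θ ψ) Filter.atTop := by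
  rw [Filter.mem_limsup_iff_frequently_mem] at h
  refine mem_limsup_approxBall_of_frequently hθ hx (h.mono fun l hl => ?_)
  simp only [blockSet, Set.mem_iUnion, exists_prop, Metric.mem_ball] at hl
  obtain ⟨y, hy, hxy⟩ := hl
  rw [dist_comm, dist_eq_norm] at hxy
  have h1 : 1 ≤ blockPoint θ l y := Nat.succ_pos _
  refine ⟨blockPoint θ l y, ⟨h1, hxy.trans_le ((min_le_left _ _).trans ?_)⟩, hxy.trans_le ?_⟩
  · exact hψ.anti _ _ h1 (blockPoint_le_run hy)
  · refine (runRadius_le θ ψ l y.1).trans ?_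
    have h0 := convDenom_cast_pos θ l
    have h2 : (convDenom θ l : ℝ) ≤ convDenom θ (l + 1) := by
      exact_mod_cast convDenom_mono θ (Nat.le_succ l)
    gcongr
    · norm_num
    · linarith

/-- Comparison of `ψ ^ τ` with the radii of the blocks. -/
theorem rpow_le_mul_runRadius {τ c : ℝ} (hτ : 1 ≤ τ) (hc : 0 < c) (hθ : Irrational θ)
    (hψ : IsApproxSeq ψ)
    (hΩ : ∀ n : ℕ, 1 ≤ n → c / (n : ℝ) ^ τ ≤ distInt (n * θ)) {l : ℕ}
    (hl : ψ (convDenom θ l) ≤ 2 / convDenom θ l) (j : ℕ) :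
    ψ ((j + 1) * convDenom θ l) ^ τ ≤ 2 ^ τ * (1 + 4 / c) * runRadius θ ψ l j := by
  have hq := convDenom_cast_pos θ l
  have hq1 : (1 : ℝ) ≤ convDenom θ l := by exact_mod_cast convDenom_pos θ l
  have hq' := convDenom_cast_pos θ (l + 1)
  have hx0 : 0 < ψ ((j + 1) * convDenom θ l) :=
    hψ.pos _ (Nat.mul_pos (Nat.succ_pos j) (convDenom_pos θ l))
  have hx1 : ψ ((j + 1) * convDenom θ l) ≤ 2 / convDenom θ l :=
    (hψ.anti _ _ (convDenom_pos θ l) (Nat.le_mul_of_pos_left _ (Nat.succ_pos j))).trans hl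
  rw [runRadius]
  set x := ψ ((j + 1) * convDenom θ l)
  have hx2 : x ≤ 2 := hx1.trans (div_le_self (by norm_num) hq1)
  have h2 : (0 : ℝ) < 2 ^ τ := by positivity
  have hK : 1 ≤ 1 + 4 / c := by linarith [div_pos (by norm_num : (0 : ℝ) < 4) hc]
  -- Against `ψ` itself, `x ≤ 2` suffices. Against the cap, `x ≤ 2 / q_l` and `c / q_l^τ ≤ ‖q_l θ‖ ≤
  -- 1 / q_{l+1}` are used.
  rw [mul_min_of_nonneg _ _ (by positivity)]
  refine le_min ?_ ?_
  · calc x ^ τ = x ^ (τ - 1) * x := by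
          rw [Real.rpow_sub_one hx0.ne']; field_simp
      _ ≤ 2 ^ τ * x := by
          gcongr
          exact (Real.rpow_le_rpow hx0.le hx2 (by linarith)).trans
            (Real.rpow_le_rpow_of_exponent_le (by norm_num) (by linarith))
      _ ≤ 2 ^ τ * (1 + 4 / c) * x := by
          gcongr
          exact le_mul_of_one_le_right h2.le hK
  · have hd := (hΩ _ (convDenom_pos θ l)).trans (distInt_convDenom_mul_le hθ l)
    calc x ^ τ ≤ (2 / convDenom θ l) ^ τ := Real.rpow_le_rpow hx0.le hx1 (by linarith)
      _ = 2 ^ τ / c * (c / (convDenom θ l : ℝ) ^ τ) := by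
          rw [Real.div_rpow (by norm_num) hq.le]; field_simp
      _ ≤ 2 ^ τ / c * (1 / convDenom θ (l + 1)) := by gcongr
      _ = 2 ^ τ * (4 / c) * (1 / (4 * convDenom θ (l + 1))) := by field_simp
      _ ≤ _ := by gcongr; linarith

/-- Each run `[(j+1)q, (j+2)q)` is bounded by its first value; the last run may overshoot `Q`. The
sample point `(j+1)q` is also the end of run `j` of a block, where `runRadius` evaluates `ψ`. -/
theorem sum_Ico_le_mul_sum {f : ℕ → ℝ} (hf0 : ∀ n, 1 ≤ n → 0 ≤ f n)
    (hf : ∀ m n, 1 ≤ m → m ≤ n → f n ≤ f m) {q Q : ℕ} (hq : 1 ≤ q) :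
    ∑ n ∈ Finset.Ico q Q, f n ≤ q * ∑ j ∈ Finset.range (Q / q), f ((j + 1) * q) := by
  have h : ∀ a : ℕ, ∑ n ∈ Finset.Ico q ((a + 1) * q), f n
      ≤ q * ∑ j ∈ Finset.range a, f ((j + 1) * q) := by
    intro a
    induction a with
    | zero => simp
    | succ a ih =>
      have h1 : q ≤ (a + 1) * q := Nat.le_mul_of_pos_left _ (Nat.succ_pos a)
      have h2 : (a + 1) * q ≤ (a + 1 + 1) * q := Nat.mul_le_mul_right _ (Nat.le_succ _)
      rw [← Finset.sum_Ico_consecutive _ h1 h2, Finset.sum_range_succ, mul_add]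
      refine add_le_add ih ?_
      refine (Finset.sum_le_card_nsmul _ _ (f ((a + 1) * q)) fun n hn =>
        hf _ _ (hq.trans h1) (Finset.mem_Ico.1 hn).1).trans_eq ?_
      rw [Nat.card_Ico, nsmul_eq_mul, Nat.succ_mul (a + 1), Nat.add_sub_cancel_left]
  refine le_trans ?_ (h (Q / q))
  refine Finset.sum_le_sum_of_subset_of_nonneg (Finset.Ico_subset_Ico_right ?_)
    fun n hn _ => hf0 n (hq.trans (Finset.mem_Ico.1 hn).1)
  rw [mul_comm]
  exact (Nat.lt_mul_div_succ Q hq).le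

theorem not_summable_measureReal_blockSet {τ c : ℝ} (hτ : 1 ≤ τ) (hc : 0 < c) (hθ : Irrational θ)
    (hψ : IsApproxSeq ψ) (hΩ : ∀ n : ℕ, 1 ≤ n → c / (n : ℝ) ^ τ ≤ distInt (n * θ))
    (hdiv : PowDiverges τ ψ)
    (hsmall : ∀ᶠ l in Filter.atTop, ψ (convDenom θ l) ≤ 2 / convDenom θ l) :
    ¬ Summable fun l => volume.real (blockSet θ ψ l) := by
  intro hsum
  apply hdiv
  rw [summable_nat_add_iff (f := fun n => ψ n ^ τ) 1]
  obtain ⟨L, hL⟩ := Filter.eventually_atTop.1 hsmall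
  set K := 2 ^ τ * (1 + 4 / c)
  have hf0 : ∀ n, 1 ≤ n → 0 ≤ ψ n ^ τ := fun n hn => Real.rpow_nonneg (hψ.pos n hn).le _
  refine summable_of_sum_Ico_le (u := fun l => convDenom θ (l + L))
    (b := fun l => K / 2 * volume.real (blockSet θ ψ (l + L)))
    (fun a b hab => convDenom_mono θ (Nat.add_le_add_right hab L))
    ((convDenom_tendsto hθ).comp (Filter.tendsto_add_atTop_nat L))
    (fun n hn => hf0 n ((convDenom_pos θ _).trans hn))
    (((summable_nat_add_iff L).2 hsum).mul_left _) fun l => ?_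
  have e : l + 1 + L = l + L + 1 := by omega
  simp only [e]
  refine (sum_Ico_le_mul_sum hf0 (fun m n hm hmn => Real.rpow_le_rpow
    (hψ.pos n (hm.trans hmn)).le (hψ.anti m n hm hmn) (by linarith))
    (convDenom_pos θ (l + L))).trans ?_
  rw [measureReal_blockSet' hθ hψ]
  calc _ ≤ (convDenom θ (l + L) : ℝ) *
        ∑ j ∈ Finset.range (convDenom θ (l + L + 1) / convDenom θ (l + L)),
          K * runRadius θ ψ (l + L) j := by
        gcongr with j _
        exact rpow_le_mul_runRadius hτ hc hθ hψ hΩ (hL _ (Nat.le_add_left L l)) j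
    _ = _ := by
        rw [← Finset.mul_sum, ← Finset.mul_sum]
        ring

end

/-! ### The theorem -/

theorem irrational_of_mem_omegaSet {τ θ : ℝ} (hθ : θ ∈ omegaSet τ) : Irrational θ := by
  rintro ⟨q, rfl⟩
  obtain ⟨c, hc, h⟩ := hθ
  have h1 := h q.den q.den_pos
  have hq : (q.den : ℝ) * q = q.num := by exact_mod_cast q.den_mul_eq_num
  have h2 : distInt (q.den * q) = 0 := by rw [hq]; simp [distInt]
  have h3 : (0 : ℝ) < q.den := by exact_mod_cast q.den_pos
  have : 0 < c / (q.den : ℝ) ^ τ := by positivity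
  linarith

theorem omegaSet_subset_thetaSet {τ : ℝ} (hτ : 1 ≤ τ) : omegaSet τ ⊆ thetaSet τ := by
  intro θ hθ ψ hψ hdiv
  have hirr := irrational_of_mem_omegaSet hθ
  obtain ⟨c, hc, hΩ⟩ := hθ
  have key : ∀ᵐ x : UnitAddCircle, x ∈ Filter.limsup (approxBall θ ψ) Filter.atTop := by
    by_cases hlarge : ∃ᶠ l in Filter.atTop, 2 / (convDenom θ l : ℝ) ≤ ψ (convDenom θ l)
    · filter_upwards [ae_ne_nsmul θ] with x hx
      exact mem_limsup_of_frequently_large hirr hψ hlarge hx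
    · have hsmall := (Filter.not_frequently.1 hlarge).mono fun l hl => (not_le.1 hl).le
      refine ae_mem_limsup_approxBall hirr hψ ?_
      refine (volume_limsup_blockSet_pos hirr hψ
        (not_summable_measureReal_blockSet hτ hc hirr hψ hΩ hdiv hsmall)).trans_le ?_
      refine measure_mono_ae ?_
      filter_upwards [ae_ne_nsmul θ] with x hx h
      exact mem_limsup_of_mem_limsup_blockSet hirr hψ hx h
  filter_upwards [ae_real_of_ae_circle key] with s hs
  rw [mem_limsup_approxBall] at hs
  have e : solutions θ ψ s = {n | (s : UnitAddCircle) ∈ approxBall θ ψ n} := by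
    ext n
    change _ ∧ _ ↔ _ ∧ _
    rw [distInt_natCast_mul_sub]
  rwa [e]

theorem thetaSet_subset_omegaSet {τ : ℝ} (hτ : 1 ≤ τ) : thetaSet τ ⊆ omegaSet τ := by
  intro θ hθ
  by_contra hnot
  obtain ⟨v, hv⟩ := exists_isTsengBase hnot
  obtain ⟨ψ, hψ⟩ := hv.exists_isTsengSeq hτ
  have h1 := hθ ψ hψ.approxSeq (hψ.powDiverges hv hτ)
  obtain ⟨s, hs1, hs2⟩ := (h1.and (hψ.ae_finite_solutions hv hτ)).exists
  exact hs1 hs2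

theorem mainTheorem2 :
    -- Tseng's theorem
    (∀ τ : ℝ, 1 ≤ τ → omegaSet τ = thetaSet τ) ∧
    -- the case `τ = 1`: Kurzweil's theorem
    (∀ θ : ℝ, θ ∈ badlyApproximable ↔
      ∀ ψ : ℕ → ℝ, IsApproxSeq ψ → ¬ Summable (fun n : ℕ => ψ (n + 1)) →
        ∀ᵐ s : ℝ, (solutions θ ψ s).Infinite) ∧
    -- Tseng's counterexample sequences for `θ` outside `Ω^{(τ)}`
    (∀ τ : ℝ, 1 ≤ τ → ∀ θ : ℝ, θ ∉ omegaSet τ →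
      (∃ v : ℕ → ℕ, IsTsengBase τ θ v) ∧
      ∀ v : ℕ → ℕ, IsTsengBase τ θ v →
        (∃ ψ : ℕ → ℝ, IsTsengSeq τ v ψ) ∧
        ∀ ψ : ℕ → ℝ, IsTsengSeq τ v ψ →
          PowDiverges τ ψ ∧
          (Irrational θ → Summable (blockSum θ ψ)) ∧
          ∀ᵐ s : ℝ, (solutions θ ψ s).Finite) := by
  have hmain : ∀ τ : ℝ, 1 ≤ τ → omegaSet τ = thetaSet τ := fun τ hτ =>
    (omegaSet_subset_thetaSet hτ).antisymm (thetaSet_subset_omegaSet hτ)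
  refine ⟨hmain, fun θ => ?_, fun τ hτ θ hθ => ⟨exists_isTsengBase hθ, fun v hv =>
    ⟨hv.exists_isTsengSeq hτ, fun ψ hψ => ⟨hψ.powDiverges hv hτ, hψ.summable_blockSum hv hτ,
      hψ.ae_finite_solutions hv hτ⟩⟩⟩⟩
  have h1 : θ ∈ badlyApproximable ↔ θ ∈ omegaSet 1 := by
    simp only [badlyApproximable, omegaSet, Real.rpow_one]
  rw [h1, hmain 1 le_rfl]
  simp only [thetaSet, PowDiverges, Real.rpow_one, Set.mem_ofPred_eq]
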